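/- Let $U\subseteq\mathbb R^n$ be open and let $\lambda=(\lambda^1,\dots,\lambda^n)$ be smooth on $U$ with $\lambda^i(u)\ne\lambda^j(u)$ for all $u\in U$ and $i\ne j$. Consider the system $$u^i_t=\lambda^i(u)\,u^i_x,\qquad i=1,\dots,n. \qquad(1)$$ For $p\ge 0$ let $J^p$ be the space with coordinates $x,t$ and $u^j_r$ ($1\le j\le n$, $0\le r\le p$; $u^j_0=u^j$, $u^j_r=\partial_x^ru^j$), with $(u^1,\dots,u^n)\in U$, and let $D_x$ be the total $x$-derivative. The $i$-th Monge characteristic distribution of (1) on $J^p$ is cut by $$dx+\lambda^i\,dt=0,\qquad du^j_r=\bigl(D_x^r(\lambda^ju^j_x)-\lambda^iu^j_{r+1}\bigr)dt\quad(r<p\ \text{or}\ j=i),$$ where for $r=p$, $j=i$ the right-hand side does not contain $u_{p+1}$. Riemann invariants are smooth local first integrals of this distribution; $u^i$ is one. The distribution admits an extra Riemann invariant of order at most $p$ if, near each point of some open dense subset of $J^p$, it has a Riemann invariant $F$ with $du^i$ and $dF$ linearly independent. System (1) is Darboux integrable if for each $i$ there is a $p$ such that the $i$-th Monge distribution admits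 an extra Riemann invariant of order at most $p$, and Darboux integrable in order at most $p$ if this $p$ serves for every $i$. Put $a_{ik}=\partial_k\lambda^i/(\lambda^k-\lambda^i)$ for $i\ne k$, and let $\mu=(\mu^1,\dots,\mu^n)$ be any smooth solution on $U$ of $$\partial_k\mu^i=a_{ik}(\mu^k-\mu^i),\qquad i\ne k.$$ If (1) is Darboux integrable, then the commuting flow $u^i_\tau=\mu^i(u)u^i_x$, $i=1,\dots,n$, is Darboux integrable, its Monge distributions being those given by the above formulas with $\mu,\tau$ in place of $\lambda,t$. Moreover, for each $p$, if (1) is Darboux integrable in order at most $p$, then so is the commuting flow. -/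

import Mathlib

open scoped ContDiff Topology

/-- The field of coefficients `u^i_t = lam^i(u) u^i_x` is `lam : (Fin n → ℝ) → Fin n → ℝ`,
and `partialDeriv lam i j u` is `∂ lam^i / ∂ u^j` at `u`. -/
noncomputable def partialDeriv {n : ℕ} (lam : (Fin n → ℝ) → Fin n → ℝ) (i j : Fin n)
    (u : Fin n → ℝ) : ℝ :=
  fderiv ℝ (fun w : Fin n → ℝ => lam w i) u (Pi.single j 1)

/-- Strict hyperbolicity on `U`: the characteristic speeds are pairwise distinct. -/
def StrictlyHyperbolicOn {n : ℕ} (lam : (Fin n → ℝ) → Fin n → ℝ) (U : Set (Fin n → ℝ)) : Prop :=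
  ∀ u ∈ U, ∀ i j : Fin n, i ≠ j → lam u i ≠ lam u j

/-- `a_{ij} = ∂_j lam^i / (lam^j - lam^i)`. -/
noncomputable def aCoeff {n : ℕ} (lam : (Fin n → ℝ) → Fin n → ℝ) (i j : Fin n)
    (u : Fin n → ℝ) : ℝ :=
  partialDeriv lam i j u / (lam u j - lam u i)

/-- The commuting-flow system `∂_k mu^i = a_{ik} (mu^k - mu^i)`, `i ≠ k`, on `U`, where the
`a_{ik}` are those of `lam`. -/
def SolvesCommutingSystemOn {n : ℕ} (lam mu : (Fin n → ℝ) → Fin n → ℝ)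
    (U : Set (Fin n → ℝ)) : Prop :=
  ∀ u ∈ U, ∀ i k : Fin n, i ≠ k →
    partialDeriv mu i k u = aCoeff lam i k u * (mu u k - mu u i)

/-- The values `(u, u_x, u_xx, …)` of `u` and its `x`-derivatives up to order `p`:
`q r j` is the `r`-th `x`-derivative of `u^j`. -/
abbrev JetFiber (n p : ℕ) : Type := Fin (p + 1) → Fin n → ℝ

/-- The space `ℝ^{2 + (p + 1) n}` with coordinates `x`, `t`, `u`, `u_x`, …, up to order `p`; it
carries the system (`p = 1`) and its prolongations (`p ≥ 2`). For `z : JetSpace n p`, `z.1` is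
`x`, `z.2.1` is `t` and `z.2.2` are the values of `u` and its derivatives. -/
abbrev JetSpace (n p : ℕ) : Type := ℝ × ℝ × JetFiber n p

/-- The coordinate `u^j_r` for any `r : ℕ`, set to `0` when `r > p`. -/
def jetCoord {n p : ℕ} (r : ℕ) (j : Fin n) (q : JetFiber n p) : ℝ :=
  if h : r < p + 1 then q ⟨r, h⟩ j else 0

/-- The total derivative `D_x = ∑_{r, k} u^k_{r+1} ∂_{u^k_r}` on functions of `u, u_x, …` only,
with the convention `u_{p+1} = 0`. -/
noncomputable def totalDeriv {n p : ℕ} (G : JetFiber n p → ℝ) : JetFiber n p → ℝ :=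
  fun q => fderiv ℝ G q (fun r k => jetCoord (r.val + 1) k q)

/-- `D_x^r (lam^j u^j_x)`, which is `∂_t u^j_r` by virtue of the system. The convention
`u_{p+1} = 0` of `totalDeriv` plays no role for `r < p`; for `r = p` it removes exactly the term
`lam^j u^j_{p+1}`. -/
noncomputable def timeDeriv {n p : ℕ} (lam : (Fin n → ℝ) → Fin n → ℝ) (r : ℕ) (j : Fin n) :
    JetFiber n p → ℝ :=
  (totalDeriv^[r]) (fun q => lam (q 0) j * jetCoord 1 j q)

/-- The `i`-th Monge characteristic distribution of the system `u^j_t = lam^j(u) u^j_x` in the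
space of jets of order `p`. It is cut by `dx + lam^i dt = 0`, by the contact relations
`du^j_r = u^j_{r+1} dx + D_x^r(lam^j u^j_x) dt` for `r < p`, in which `dx = - lam^i dt`, and by
`du^i_p = (D_x^p(lam^i u^i_x) - lam^i u^i_{p+1}) dt`, whose right-hand side does not contain
`u_{p+1}`. For `p = 1` these are `dx + lam^i dt = 0`, `du^i = 0`,
`du^j + (lam^i - lam^j) u^j_x dt = 0` for `j ≠ i`, and `du^i_x - D_x(lam^i) u^i_x dt = 0`. -/
def mongeDistribution {n p : ℕ} (lam : (Fin n → ℝ) → Fin n → ℝ) (i : Fin n)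
    (z : JetSpace n p) : Submodule ℝ (JetSpace n p) where
  carrier := {v | v.1 + lam (z.2.2 0) i * v.2.1 = 0 ∧
    ∀ (r : Fin (p + 1)) (j : Fin n), (r.val < p ∨ j = i) →
      v.2.2 r j =
        (timeDeriv lam r.val j z.2.2 - lam (z.2.2 0) i * jetCoord (r.val + 1) j z.2.2) * v.2.1}
  zero_mem' := by
    refine ⟨by simp, fun r j _ => by simp⟩
  add_mem' := by
    rintro a b ⟨ha, ha'⟩ ⟨hb, hb'⟩
    refine ⟨?_, fun r j h => ?_⟩
    · simp only [Prod.fst_add, Prod.snd_add]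
      linear_combination ha + hb
    · simp only [Prod.snd_add, Prod.fst_add, Pi.add_apply]
      linear_combination ha' r j h + hb' r j h
  smul_mem' := by
    rintro c a ⟨ha, ha'⟩
    refine ⟨?_, fun r j h => ?_⟩
    · simp only [Prod.smul_fst, Prod.smul_snd, smul_eq_mul]
      linear_combination c * ha
    · simp only [Prod.smul_snd, Prod.smul_fst, Pi.smul_apply, smul_eq_mul]
      linear_combination c * ha' r j h

/-- A Riemann invariant of the `i`-th Monge distribution on the open set `V`: a smooth first
integral of it. -/
def IsRiemannInvariantOn {n p : ℕ} (lam : (Fin n → ℝ) → Fin n → ℝ) (i : Fin n)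
    (V : Set (JetSpace n p)) (F : JetSpace n p → ℝ) : Prop :=
  ContDiffOn ℝ ∞ F V ∧ ∀ z ∈ V, ∀ v ∈ mongeDistribution lam i z, fderiv ℝ F z v = 0

/-- A Riemann invariant that is functionally independent of the obvious one, `u^i`. -/
def IsExtraRiemannInvariantOn {n p : ℕ} (lam : (Fin n → ℝ) → Fin n → ℝ) (i : Fin n)
    (V : Set (JetSpace n p)) (F : JetSpace n p → ℝ) : Prop :=
  IsRiemannInvariantOn lam i V F ∧
    ∀ z ∈ V, LinearIndependent ℝ
      ![fderiv ℝ (fun w : JetSpace n p => w.2.2 0 i) z, fderiv ℝ F z]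

/-- The jets of order `p` at the points of `U`. -/
def jetsOver {n : ℕ} (p : ℕ) (U : Set (Fin n → ℝ)) : Set (JetSpace n p) :=
  {z | z.2.2 0 ∈ U}

/-- The `i`-th Monge distribution of the system on `U` admits an extra Riemann invariant of order
at most `p`: one exists near each point of an open dense set of jets of order `p` over `U`
(first integrals are local objects, considered near generic points). -/
def AdmitsExtraRiemannInvariant {n : ℕ} (lam : (Fin n → ℝ) → Fin n → ℝ) (U : Set (Fin n → ℝ))
    (p : ℕ) (i : Fin n) : Prop :=
  ∃ W : Set (JetSpace n p), IsOpen W ∧ W ⊆ jetsOver p U ∧ jetsOver p U ⊆ closure W ∧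
    ∀ z ∈ W, ∃ V : Set (JetSpace n p), IsOpen V ∧ z ∈ V ∧ V ⊆ W ∧
      ∃ F : JetSpace n p → ℝ, IsExtraRiemannInvariantOn lam i V F

/-- Darboux integrability: each Monge distribution admits, possibly after prolongation, at least
one extra Riemann invariant. -/
def DarbouxIntegrable {n : ℕ} (lam : (Fin n → ℝ) → Fin n → ℝ) (U : Set (Fin n → ℝ)) : Prop :=
  ∀ i : Fin n, ∃ p : ℕ, AdmitsExtraRiemannInvariant lam U p i

/-- Darboux integrability in order at most `p`. With `p = 1` only the system itself is used,
without prolongation. -/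
def DarbouxIntegrableInOrder {n : ℕ} (lam : (Fin n → ℝ) → Fin n → ℝ) (U : Set (Fin n → ℝ))
    (p : ℕ) : Prop :=
  ∀ i : Fin n, AdmitsExtraRiemannInvariant lam U p i

/-! Fix `i` and put T = ∂_t - λ^i ∂_x and S = -μ^i ∂_x, both prolonged to jets with the
characteristic direction of their own flow (`charField` with `s = 1` and `s = 0`). The
λ-distribution is spanned by T and the vertical fields ∂/∂u^k_p, k ≠ i; the μ-distribution is
spanned by ∂_τ + S and the same vertical fields.

Since the flows commute, S maps Riemann invariants of λ to Riemann invariants of λ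
(`IsRiemannInvariantOn.lieDeriv`). The bracket [T, S] lies in the distribution. The bracket
[∂/∂u^k_p, S] need not, but modulo the distribution (λ^k - λ^i)[∂/∂u^k_p, S] equals (μ^k -
μ^i)[∂/∂u^k_p, T], and every first integral of the distribution kills [∂/∂u^k_p, T].

Starting from an extra invariant F, restrict u^i, F, SF, S²F, … to a slice t = t₀, to which S is
tangent. Only finitely many differentials can be independent, so near a suitable point the first
ones are independent and the next function depends on them: S descends to a vector field W in
finitely many variables. Flowing backwards along W turns F into a τ-dependent function G that is
killed by ∂_τ + S and by the vertical fields, hence a Riemann invariant of μ. At τ = t₀ it equals F,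
so it is independent of u^i (`exists_timeDependent_firstIntegral`,
`IsExtraRiemannInvariantOn.exists_commuting`). The order p never changes. The suitable point can be
found in any nonempty open set, which gives density.

The analytic input is a smooth first integral of ∂_t + W, obtained from a contraction on path space
(`exists_firstIntegral`), and the local factorization of a function through a submersion
(`exists_eventuallyEq_comp_of_ker_le`). -/

section PathSpace

-- Calculus on the space of continuous paths.

universe u

variable {E F : Type*} [NormedAddCommGroup E] [NormedSpace ℝ E]
  [NormedAddCommGroup F] [NormedSpace ℝ F]

/-- Pointwise application of a continuous family of linear maps to a continuous family of
vectors. -/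
noncomputable def pointwiseApply (K : Type*) [TopologicalSpace K] [CompactSpace K] (E F : Type*)
    [NormedAddCommGroup E] [NormedSpace ℝ E] [NormedAddCommGroup F] [NormedSpace ℝ F] :
    C(K, E →L[ℝ] F) →L[ℝ] C(K, E) →L[ℝ] C(K, F) :=
  LinearMap.mkContinuous₂
    (LinearMap.mk₂ ℝ (fun (A : C(K, E →L[ℝ] F)) (η : C(K, E)) =>
      (⟨fun s => A s (η s), by fun_prop⟩ : C(K, F)))
      (fun _ _ _ => by ext; simp) (fun _ _ _ => by ext; simp)
      (fun _ _ _ => by ext; simp) (fun _ _ _ => by ext; simp)) 1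
    (fun A η => by
      rw [ContinuousMap.norm_le _ (by positivity), one_mul]
      intro s
      exact (A s).le_of_opNorm_le_of_le (A.norm_coe_le_norm s) (η.norm_coe_le_norm s))

@[simp] theorem pointwiseApply_apply {K : Type*} [TopologicalSpace K] [CompactSpace K]
    (A : C(K, E →L[ℝ] F)) (η : C(K, E)) (s : K) : pointwiseApply K E F A η s = A s (η s) := rfl

/-- Uniform continuity of `f'` makes the mean value estimate on a ball of radius `δ` uniform in the
base point, so the pointwise remainder bound passes to the sup norm. -/
theorem hasFDerivAt_postcomp {K : Type*} [TopologicalSpace K] [CompactSpace K]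
    (f : C(E, F)) (f' : C(E, E →L[ℝ] F)) (hf : ∀ x, HasFDerivAt f (f' x) x)
    (hu : UniformContinuous f') (γ : C(K, E)) :
    HasFDerivAt (fun γ : C(K, E) => f.comp γ) (pointwiseApply K E F (f'.comp γ)) γ := by
  refine HasFDerivAt.of_isLittleO (Asymptotics.isLittleO_iff.2 fun c hc => ?_)
  obtain ⟨δ, hδ, h⟩ := Metric.uniformContinuous_iff.1 hu c hc
  filter_upwards [Metric.ball_mem_nhds γ hδ] with γ' hγ'
  rw [ContinuousMap.norm_le _ (by positivity)]
  intro s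
  have hs : dist (γ' s) (γ s) < δ := (ContinuousMap.dist_apply_le_dist s).trans_lt hγ'
  have key := Convex.norm_image_sub_le_of_norm_hasFDerivWithin_le' (f := f) (C := c)
    (s := Metric.ball (γ s) δ) (x := γ s) (y := γ' s) (φ := f' (γ s))
    (fun x _ => (hf x).hasFDerivWithinAt)
    (fun x hx => by simpa [dist_eq_norm] using (h hx).le) (convex_ball _ _)
    (Metric.mem_ball_self hδ) hs
  refine key.trans ?_
  gcongr
  exact (γ' - γ).norm_coe_le_norm s

/-- The derivative at `γ` is pointwise application of `f' ∘ γ`, that is, postcomposition with `f'`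
followed by a bounded linear map, so the claim for `f'` gives the next order. The induction
therefore changes the target to `E →L[ℝ] F`, which is why `F` is quantified inside and shares the
universe of `E`. Compact support supplies the uniform continuity. -/
theorem contDiff_nat_postcomp {K : Type*} [TopologicalSpace K] [CompactSpace K] {E : Type u}
    [NormedAddCommGroup E] [NormedSpace ℝ E] (k : ℕ) :
    ∀ {F : Type u} [NormedAddCommGroup F] [NormedSpace ℝ F] (f : C(E, F)),
      HasCompactSupport f → ContDiff ℝ (k + 1) f →
      ContDiff ℝ k (fun γ : C(K, E) => f.comp γ) := by
  induction k with
  | zero =>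
    intro F _ _ f _ _
    exact contDiff_zero.2 (ContinuousMap.continuous_postcomp f)
  | succ k ih =>
    intro F _ _ f hc hf
    have hf' : ContDiff ℝ (k + 1) (fderiv ℝ f) := by
      have := hf.fderiv_right (m := k + 1) (by push_cast; exact le_rfl)
      exact this
    have hcs : HasCompactSupport (fderiv ℝ f) := hc.fderiv (𝕜 := ℝ)
    let f' : C(E, E →L[ℝ] F) := ⟨fderiv ℝ f, hf'.continuous⟩
    push_cast
    rw [contDiff_succ_iff_hasFDerivAt]
    refine ⟨fun γ => pointwiseApply K E F (f'.comp γ), ?_, fun γ => ?_⟩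
    · exact (pointwiseApply K E F).contDiff.comp (ih f' hcs hf')
    · exact hasFDerivAt_postcomp f f'
        (fun x => (hf.differentiable (by simp) x).hasFDerivAt)
        (hcs.uniformContinuous_of_continuous hf'.continuous) γ

theorem contDiff_postcomp {K : Type*} [TopologicalSpace K] [CompactSpace K] {E F : Type u}
    [NormedAddCommGroup E] [NormedSpace ℝ E] [NormedAddCommGroup F] [NormedSpace ℝ F]
    (f : C(E, F)) (hc : HasCompactSupport f) (hf : ContDiff ℝ ∞ f) :
    ContDiff ℝ ∞ (fun γ : C(K, E) => f.comp γ) :=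
  contDiff_infty.2 fun k => contDiff_nat_postcomp k f hc (hf.of_le (by exact_mod_cast le_top))

/-- The integral `s ↦ ∫ r in 0..s, g r` of a path. -/
noncomputable def pathIntegral (E : Type*) [NormedAddCommGroup E] [NormedSpace ℝ E] :
    C(unitInterval, E) →L[ℝ] C(unitInterval, E) :=
  LinearMap.mkContinuous
    { toFun := fun g => ⟨fun s => ∫ r in (0 : ℝ)..s, Set.IccExtend zero_le_one g r,
        (intervalIntegral.continuous_primitive
          (fun a b => (g.continuous.Icc_extend' (h := zero_le_one)).intervalIntegrable a b) 0).comp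
          continuous_subtype_val⟩
      map_add' := fun g h => by
        ext s
        exact intervalIntegral.integral_add
          ((g.continuous.Icc_extend' (h := zero_le_one)).intervalIntegrable _ _)
          ((h.continuous.Icc_extend' (h := zero_le_one)).intervalIntegrable _ _)
      map_smul' := fun c g => by
        ext s
        exact intervalIntegral.integral_smul c _ } 1
    (fun g => by
      rw [ContinuousMap.norm_le _ (by positivity), one_mul]
      intro s
      have := intervalIntegral.norm_integral_le_of_norm_le_const (a := 0) (b := (s : ℝ))
        (f := Set.IccExtend zero_le_one g) (C := ‖g‖) (fun r _ => g.norm_coe_le_norm _)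
      refine this.trans ?_
      have h0 := s.2.1
      have h1 := s.2.2
      rw [sub_zero, abs_of_nonneg h0]
      exact mul_le_of_le_one_right (norm_nonneg _) h1)

theorem pathIntegral_apply (g : C(unitInterval, E)) (s : unitInterval) :
    pathIntegral E g s = ∫ r in (0 : ℝ)..s, Set.IccExtend zero_le_one g r := rfl

theorem norm_pathIntegral_le (g : C(unitInterval, E)) : ‖pathIntegral E g‖ ≤ ‖g‖ := by
  refine ((pathIntegral E).le_opNorm g).trans ?_
  have : ‖pathIntegral E‖ ≤ 1 := LinearMap.mkContinuous_norm_le _ zero_le_one _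
  exact mul_le_of_le_one_left (norm_nonneg _) this

/-- The constant paths. -/
noncomputable def constPath (E : Type*) [NormedAddCommGroup E] [NormedSpace ℝ E] :
    E →L[ℝ] C(unitInterval, E) :=
  LinearMap.mkContinuous
    { toFun := fun y => ContinuousMap.const _ y
      map_add' := fun _ _ => by ext; rfl
      map_smul' := fun _ _ => by ext; rfl } 1
    (fun y => by
      rw [ContinuousMap.norm_le _ (by positivity), one_mul]
      exact fun s => le_rfl)

@[simp] theorem constPath_apply (y : E) (s : unitInterval) : constPath E y s = y := rfl

end PathSpace

/-! ### Smooth dependence of fixed points, and first integrals of vector fields. -/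

/-- The fixed point of a contraction depends smoothly on parameters, and its derivative is the
fixed point of the linearized contraction. -/
theorem exists_contDiffOn_fixedPoint {P X : Type*} [NormedAddCommGroup P] [NormedSpace ℝ P]
    [CompleteSpace P] [NormedAddCommGroup X] [NormedSpace ℝ X] [CompleteSpace X]
    (Φ : P × X → X) (hΦ : ContDiff ℝ ∞ Φ) (O : Set P)
    (hcontr : ∀ p ∈ O, ∃ K : NNReal, K < 1 ∧ LipschitzWith K (fun γ => Φ (p, γ))) :
    ∃ γ : P → X, (∀ p ∈ O, Φ (p, γ p) = γ p ∧ ∀ γ', Φ (p, γ') = γ' → γ' = γ p) ∧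
      (∀ p ∈ interior O, ContDiffAt ℝ ∞ γ p) ∧
      ∀ p ∈ interior O, ∀ v ζ, fderiv ℝ Φ (p, γ p) (v, ζ) = ζ → fderiv ℝ γ p v = ζ := by
  classical
  have hex : ∀ p, ∃ γ, p ∈ O → Φ (p, γ) = γ ∧ ∀ γ', Φ (p, γ') = γ' → γ' = γ := by
    intro p
    by_cases hp : p ∈ O
    · obtain ⟨K, hK, hL⟩ := hcontr p hp
      have hc : ContractingWith K (fun γ => Φ (p, γ)) := ⟨hK, hL⟩
      exact ⟨hc.fixedPoint, fun _ => ⟨hc.fixedPoint_isFixedPt, fun γ' h => hc.fixedPoint_unique h⟩⟩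
    · exact ⟨0, fun h => absurd h hp⟩
  choose γ hγ using hex
  -- The Lipschitz constant bounds the partial derivative in the second variable, so `1` minus it is
  -- invertible and the implicit function theorem applies.
  have hpart : ∀ p ∈ O, ∀ x, ‖fderiv ℝ Φ (p, x) ∘L .inr ℝ P X‖ < 1 := by
    intro p hp x
    obtain ⟨K, hK, hL⟩ := hcontr p hp
    have h1 : HasFDerivAt (fun y => Φ (p, y)) (fderiv ℝ Φ (p, x) ∘L .inr ℝ P X) x :=
      (hΦ.differentiable (by simp) (p, x)).hasFDerivAt.comp x (hasFDerivAt_prodMk_right p x)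
    exact (h1.le_of_lipschitz hL).trans_lt (by exact_mod_cast hK)
  have hsmooth : ∀ p ∈ interior O, ContDiffAt ℝ ∞ γ p := by
    intro p hp
    have hpO := interior_subset hp
    set Ψ : P × X → X := fun w => w.2 - Φ w with hΨ
    have hΨs : ContDiffAt ℝ ∞ Ψ (p, γ p) := (contDiff_snd.sub hΦ).contDiffAt
    have hd : fderiv ℝ Ψ (p, γ p) ∘L .inr ℝ P X = 1 - fderiv ℝ Φ (p, γ p) ∘L .inr ℝ P X := by
      have : HasFDerivAt Ψ (ContinuousLinearMap.snd ℝ P X - fderiv ℝ Φ (p, γ p)) (p, γ p) :=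
        hasFDerivAt_snd.sub (hΦ.differentiable (by simp) (p, γ p)).hasFDerivAt
      rw [this.fderiv]
      ext x
      simp
    have hinv : (fderiv ℝ Ψ (p, γ p) ∘L .inr ℝ P X).IsInvertible := by
      obtain ⟨u, hu⟩ := isUnit_one_sub_of_norm_lt_one (hpart p hpO (γ p))
      rw [hd, ← hu]
      exact ⟨ContinuousLinearEquiv.unitsEquiv ℝ X u, rfl⟩
    have hz : Ψ (p, γ p) = 0 := by simp [hΨ, (hγ p hpO).1]
    refine (hΨs.contDiffAt_implicitFunction (by simp) hinv).congr_of_eventuallyEq ?_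
    -- Uniqueness of the fixed point identifies the implicit function with `γ` near `p`.
    filter_upwards [hΨs.eventually_apply_implicitFunction (by simp) hinv,
      mem_interior_iff_mem_nhds.1 hp] with q hq hqO
    refine ((hγ q hqO).2 _ ?_).symm
    rw [hz] at hq
    exact (sub_eq_zero.1 hq).symm
  refine ⟨γ, fun p hp => hγ p hp, hsmooth, fun p hp v ζ hζ => ?_⟩
  have hpO := interior_subset hp
  have hγd := ((hsmooth p hp).differentiableAt (by simp)).hasFDerivAt
  have h1 : HasFDerivAt (fun q => Φ (q, γ q))
      (fderiv ℝ Φ (p, γ p) ∘L ((ContinuousLinearMap.id ℝ P).prod (fderiv ℝ γ p))) p :=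
    HasFDerivAt.comp p (f := fun q => (q, γ q))
      (hΦ.differentiable (by simp) (p, γ p)).hasFDerivAt ((hasFDerivAt_id p).prodMk hγd)
  have h2 : (fun q => Φ (q, γ q)) =ᶠ[𝓝 p] γ := by
    filter_upwards [mem_interior_iff_mem_nhds.1 hp] with q hq using (hγ q hq).1
  have h3 := (h1.unique (hγd.congr_of_eventuallyEq h2))
  have h4 : fderiv ℝ Φ (p, γ p) (v, fderiv ℝ γ p v) = fderiv ℝ γ p v := by
    simpa using congrArg (fun A => A v) h3
  -- Two solutions of the linearized equation differ by a vector fixed by an operator of norm less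
  -- than `1`.
  have h5 : (fderiv ℝ Φ (p, γ p) ∘L .inr ℝ P X) (fderiv ℝ γ p v - ζ) = fderiv ℝ γ p v - ζ := by
    conv_rhs => rw [← h4, ← hζ, ← map_sub]
    simp
  by_contra hne
  have hpos : 0 < ‖fderiv ℝ γ p v - ζ‖ := norm_pos_iff.2 (sub_ne_zero.2 hne)
  have h6 := (fderiv ℝ Φ (p, γ p) ∘L .inr ℝ P X).le_opNorm (fderiv ℝ γ p v - ζ)
  rw [h5] at h6
  nlinarith [hpart p hpO (γ p)]

/-- A smooth compactly supported vector field `f` has, for small times, a first integral `ψ` of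
`∂_t + f` with prescribed value `ψ (0, y) = y`. -/
theorem exists_firstIntegral_of_hasCompactSupport {E : Type*} [NormedAddCommGroup E]
    [NormedSpace ℝ E] [CompleteSpace E] (f : E → E) (hf : ContDiff ℝ ∞ f)
    (hc : HasCompactSupport f) :
    ∃ δ > 0, ∃ ψ : ℝ × E → E, (∀ ε y, |ε| < δ → ContDiffAt ℝ ∞ ψ (ε, y)) ∧
      (∀ y, ψ (0, y) = y) ∧ ∀ ε y, |ε| < δ → fderiv ℝ ψ (ε, y) (1, f y) = 0 := by
  obtain ⟨L, hL⟩ := hf.lipschitzWith_of_hasCompactSupport hc (by simp)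
  set fC : C(E, E) := ⟨f, hf.continuous⟩ with hfC
  set f' : C(E, E →L[ℝ] E) := ⟨fderiv ℝ f, (hf.continuous_fderiv (by simp))⟩ with hf'
  set N : C(unitInterval, E) → C(unitInterval, E) := fun γ => fC.comp γ with hN
  have hNs : ContDiff ℝ ∞ N := contDiff_postcomp fC hc hf
  have hNd : ∀ γ, HasFDerivAt N (pointwiseApply unitInterval E E (f'.comp γ)) γ := fun γ =>
    hasFDerivAt_postcomp fC f' (fun x => (hf.differentiable (by simp) x).hasFDerivAt)
      ((hc.fderiv (𝕜 := ℝ)).uniformContinuous_of_continuous f'.continuous) γ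
  have hNL : LipschitzWith L N := by
    refine LipschitzWith.of_dist_le_mul fun γ γ' => ?_
    rw [ContinuousMap.dist_le (by positivity)]
    intro s
    refine (hL.dist_le_mul _ _).trans ?_
    gcongr
    exact ContinuousMap.dist_apply_le_dist s
  -- The fixed point at `(ε, y)` is the path that follows the flow of `f` from `y` for time `-ε s`.
  -- Its endpoint at `s = 1` is `ψ (ε, y)`.
  set Φ : (ℝ × E) × C(unitInterval, E) → C(unitInterval, E) := fun w =>
    constPath E w.1.2 - w.1.1 • pathIntegral E (N w.2) with hΦ
  have hΦs : ContDiff ℝ ∞ Φ := by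
    have h1 : ContDiff ℝ ∞ (fun w : (ℝ × E) × C(unitInterval, E) => N w.2) :=
      hNs.comp contDiff_snd
    have h2 := (pathIntegral E).contDiff (n := ∞).comp h1
    exact ((constPath E).contDiff.comp (contDiff_snd.comp contDiff_fst)).sub
      ((contDiff_fst.comp contDiff_fst).smul h2)
  -- This makes the contraction constant `|ε| L` less than `1`.
  set δ : ℝ := 1 / (L + 1) with hδ
  have hδ0 : 0 < δ := by positivity
  set O : Set (ℝ × E) := {p | |p.1| < δ} with hO
  have hOo : IsOpen O := isOpen_lt (by fun_prop) continuous_const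
  obtain ⟨γ, hfix, hsm, hder⟩ := exists_contDiffOn_fixedPoint Φ hΦs O (by
    intro p hp
    refine ⟨‖p.1‖₊ * L, ?_, ?_⟩
    · have h1 : |p.1| < 1 / (L + 1) := hp
      rw [lt_div_iff₀ (by positivity)] at h1
      rw [← NNReal.coe_lt_coe]
      push_cast
      rw [Real.norm_eq_abs]
      nlinarith [abs_nonneg p.1]
    · refine LipschitzWith.of_dist_le_mul fun γ γ' => ?_
      simp only [hΦ, dist_eq_norm]
      rw [sub_sub_sub_cancel_left, ← smul_sub, ← map_sub, norm_smul]
      push_cast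
      rw [mul_assoc, ← norm_neg (pathIntegral E _), ← map_neg, neg_sub]
      gcongr
      refine (norm_pathIntegral_le _).trans ?_
      simpa [dist_eq_norm] using hNL.dist_le_mul γ γ')
  rw [hOo.interior_eq] at hsm hder
  refine ⟨δ, hδ0, fun p => γ p 1, fun ε y h => ?_, fun y => ?_, fun ε y h => ?_⟩
  · exact (ContinuousMap.evalCLM ℝ (1 : unitInterval)).contDiff.contDiffAt.comp (ε, y)
      (hsm (ε, y) h)
  · have h1 := (hfix (0, y) (by simpa [hO] using hδ0)).1
    simp only [hΦ, zero_smul, sub_zero] at h1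
    change γ (0, y) 1 = y
    rw [← h1, constPath_apply]
  · set g : C(unitInterval, E) := γ (ε, y) with hg
    have hgfix : ∀ s : unitInterval,
        g s = y - ε • ∫ r in (0 : ℝ)..s, Set.IccExtend zero_le_one (N g) r := by
      intro s
      have h1 := (hfix (ε, y) h).1
      have h2 := congrArg (fun q : C(unitInterval, E) => q s) h1
      simpa [hΦ, pathIntegral_apply] using h2.symm
    set G : ℝ → E := fun r => y - ε • ∫ x in (0 : ℝ)..r, Set.IccExtend zero_le_one (N g) x with hG
    have hcont : Continuous (Set.IccExtend zero_le_one (N g)) :=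
      (N g).continuous.Icc_extend' (h := zero_le_one)
    have hGd : ∀ r, HasDerivAt G (-(ε • Set.IccExtend zero_le_one (N g) r)) r := by
      intro r
      have h1 := (hcont.integral_hasStrictDerivAt 0 r).hasDerivAt
      simpa using (h1.const_smul ε).const_sub y
    have hNG : ∀ r ∈ Set.Icc (0 : ℝ) 1, Set.IccExtend zero_le_one (N g) r = f (G r) := by
      intro r hr
      rw [Set.IccExtend_of_mem _ _ hr]
      simp only [hN, hfC, ContinuousMap.comp_apply, ContinuousMap.coe_mk]
      rw [hgfix ⟨r, hr⟩]
    -- Moving `y` along `f` and `ε` at unit speed changes the flow time at parameter `s` by `1 - s`,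
    -- so the path should vary by `(1 - s) f (g s)`. This vanishes at `s = 1`, where `ψ` is read
    -- off.
    set ζ : C(unitInterval, E) := ⟨fun s => (1 - (s : ℝ)) • f (g s), by
      have := hf.continuous; fun_prop⟩ with hζ
    have hfd : fderiv ℝ Φ ((ε, y), g) ((1, f y), ζ) = ζ := by
      have h1 : HasFDerivAt (fun w : (ℝ × E) × C(unitInterval, E) => constPath E w.1.2) _
          ((ε, y), g) :=
        ((constPath E) ∘L .snd ℝ ℝ E ∘L .fst ℝ (ℝ × E) C(unitInterval, E)).hasFDerivAt
      have h2 : HasFDerivAt (fun w : (ℝ × E) × C(unitInterval, E) => w.1.1) _ ((ε, y), g) :=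
        (ContinuousLinearMap.fst ℝ ℝ E ∘L .fst ℝ (ℝ × E) C(unitInterval, E)).hasFDerivAt
      have h3 : HasFDerivAt (fun w : (ℝ × E) × C(unitInterval, E) => pathIntegral E (N w.2)) _
          ((ε, y), g) :=
        (pathIntegral E).hasFDerivAt.comp ((ε, y), g)
          (HasFDerivAt.comp (f := Prod.snd) ((ε, y), g) (hNd g) hasFDerivAt_snd)
      have h4 : HasFDerivAt Φ _ ((ε, y), g) := h1.sub (h2.smul h3)
      rw [h4.fderiv]
      ext s
      simp only [sub_apply, ContinuousLinearMap.comp_apply,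
        add_apply, smul_apply,
        ContinuousLinearMap.smulRight_apply, ContinuousLinearMap.coe_fst',
        ContinuousLinearMap.coe_snd', ContinuousMap.sub_apply, ContinuousMap.add_apply,
        ContinuousMap.smul_apply, constPath_apply, one_smul,
        pathIntegral_apply]
      have hs := s.2
      -- Integrating this derivative from `0` to `s` gives exactly the linearized fixed-point
      -- equation for `ζ`.
      have hH : ∀ r ∈ Set.uIcc (0 : ℝ) s, HasDerivAt (fun r => (1 - r) • f (G r))
          (-(Set.IccExtend zero_le_one (N g) r +
            ε • Set.IccExtend zero_le_one
              (pointwiseApply unitInterval E E (f'.comp g) ζ) r)) r := by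
        intro r hr
        rw [Set.uIcc_of_le hs.1] at hr
        have hr' : r ∈ Set.Icc (0 : ℝ) 1 := ⟨hr.1, hr.2.trans hs.2⟩
        have h2 := ((hf.differentiable (by simp) (G r)).hasFDerivAt.comp_hasDerivAt r (hGd r))
        have h3 := ((hasDerivAt_id r).const_sub 1).smul h2
        refine h3.congr_deriv ?_
        rw [hNG r hr', Set.IccExtend_of_mem _ _ hr']
        simp only [pointwiseApply_apply, hζ, hf', ContinuousMap.comp_apply, ContinuousMap.coe_mk,
          hgfix ⟨r, hr'⟩]
        simp only [id, map_neg, map_smul, Function.comp_apply]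
        rw [show y - ε • ∫ (r : ℝ) in (0 : ℝ)..r, Set.IccExtend zero_le_one (N g) r = G r from rfl]
        module
      have hcont' : Continuous fun r => ε • Set.IccExtend zero_le_one
          (pointwiseApply unitInterval E E (f'.comp g) ζ) r :=
        ((ContinuousMap.continuous _).Icc_extend' (h := zero_le_one)).const_smul ε
      have hint := intervalIntegral.integral_eq_sub_of_hasDerivAt hH
        ((hcont.add hcont').neg.intervalIntegrable _ _)
      rw [intervalIntegral.integral_neg, intervalIntegral.integral_add
        (hcont.intervalIntegrable _ _) (hcont'.intervalIntegrable _ _),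
        intervalIntegral.integral_smul] at hint
      have hG0 : G 0 = y := by simp [hG]
      have hGs : G s = g s := (hgfix s).symm
      simp only [hG0, hGs, sub_zero, one_smul] at hint
      simp only [hζ, ContinuousMap.coe_mk]
      rw [sub_eq_iff_eq_add.1 hint.symm]
      abel
    have h2 := hder (ε, y) h (1, f y) ζ hfd
    have h3 : HasFDerivAt (fun p => γ p 1)
        ((ContinuousMap.evalCLM ℝ (1 : unitInterval)) ∘L fderiv ℝ γ (ε, y)) (ε, y) :=
      HasFDerivAt.comp (ε, y)
        (ContinuousMap.evalCLM ℝ (1 : unitInterval) : C(unitInterval, E) →L[ℝ] E).hasFDerivAt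
        ((hsm (ε, y) h).differentiableAt (by simp)).hasFDerivAt
    rw [h3.fderiv, ContinuousLinearMap.comp_apply, h2]
    simp [hζ]

/-- A smooth vector field `f` on an open set `Ω` has, locally, a first integral `ψ` of `∂_t + f`
with prescribed value `ψ (0, y) = y`. -/
theorem exists_firstIntegral {E : Type*} [NormedAddCommGroup E] [NormedSpace ℝ E]
    [FiniteDimensional ℝ E] {f : E → E} {Ω : Set E} (hΩ : IsOpen Ω) (hf : ContDiffOn ℝ ∞ f Ω)
    {y₀ : E} (hy₀ : y₀ ∈ Ω) :
    ∃ ψ : ℝ × E → E, (∀ y, ψ (0, y) = y) ∧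
      ∀ᶠ p in 𝓝 ((0 : ℝ), y₀), ContDiffAt ℝ ∞ ψ p ∧ fderiv ℝ ψ p (1, f p.2) = 0 := by
  have : CompleteSpace E := FiniteDimensional.complete ℝ E
  obtain ⟨r, hr, hrΩ⟩ := Metric.nhds_basis_closedBall.mem_iff.1 (hΩ.mem_nhds hy₀)
  -- Cutting `f` off inside `Ω` yields a global compactly supported field that agrees with `f` near
  -- `y₀`.
  let χ : ContDiffBump y₀ := ⟨r / 2, r, by positivity, by linarith⟩
  have hg : ContDiff ℝ ∞ (fun y => χ y • f y) := by
    rw [contDiff_iff_contDiffAt]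
    intro y
    by_cases hy : y ∈ Ω
    · exact χ.contDiff.contDiffAt.smul (hf.contDiffAt (hΩ.mem_nhds hy))
    · have hy' : y ∉ tsupport χ := fun h => hy (hrΩ (by simpa [χ.tsupport_eq] using h))
      refine contDiffAt_const (c := (0 : E)).congr_of_eventuallyEq ?_
      filter_upwards [notMem_tsupport_iff_eventuallyEq.1 hy'] with z hz
      simp [hz]
  have hgc : HasCompactSupport (fun y => χ y • f y) := χ.hasCompactSupport.smul_right
  obtain ⟨δ, hδ, ψ, hψs, hψ0, hψ⟩ := exists_firstIntegral_of_hasCompactSupport _ hg hgc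
  refine ⟨ψ, hψ0, ?_⟩
  have h1 : ∀ᶠ p : ℝ × E in 𝓝 ((0 : ℝ), y₀), |p.1| < δ :=
    (continuous_fst.abs.tendsto _).eventually_lt_const (by simpa using hδ)
  have h2 : ∀ᶠ p : ℝ × E in 𝓝 ((0 : ℝ), y₀), χ p.2 = 1 :=
    (continuous_snd.tendsto ((0 : ℝ), y₀)).eventually χ.eventuallyEq_one
  filter_upwards [h1, h2] with p hp1 hp2
  refine ⟨hψs p.1 p.2 hp1, ?_⟩
  simpa [hp2] using hψ p.1 p.2 hp1

/-! ### Functional dependence. -/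

/-- If `dh` vanishes on `ker dΦ` near a point at which `Φ` is a submersion, then locally `h` is a
smooth function of `Φ`. -/
theorem exists_eventuallyEq_comp_of_ker_le {Y Z : Type*} [NormedAddCommGroup Y] [NormedSpace ℝ Y]
    [FiniteDimensional ℝ Y] [NormedAddCommGroup Z] [NormedSpace ℝ Z] [FiniteDimensional ℝ Z]
    {N : Set Y} (hN : IsOpen N) {Φ : Y → Z} {h : Y → ℝ} (hΦ : ContDiffOn ℝ ∞ Φ N)
    (hh : ContDiffOn ℝ ∞ h N) {y₀ : Y} (hy₀ : y₀ ∈ N)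
    (hsurj : Function.Surjective (fderiv ℝ Φ y₀))
    (hker : ∀ y ∈ N, ∀ v, fderiv ℝ Φ y v = 0 → fderiv ℝ h y v = 0) :
    ∃ f : Z → ℝ, ∃ Ω : Set Z, IsOpen Ω ∧ Φ y₀ ∈ Ω ∧ ContDiffOn ℝ ∞ f Ω ∧
      ∀ᶠ y in 𝓝 y₀, h y = f (Φ y) := by
  have : CompleteSpace Y := FiniteDimensional.complete ℝ Y
  set A := fderiv ℝ Φ y₀ with hA
  obtain ⟨R', hR'⟩ := (A : Y →ₗ[ℝ] Z).exists_rightInverse_of_surjective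
    (LinearMap.range_eq_top.2 hsurj)
  set R : Z →L[ℝ] Y := R'.toContinuousLinearMap with hR
  have hAR : ∀ z, A (R z) = z := fun z => congrArg (fun L => L z) hR'
  -- `R` is a right inverse of `A = dΦ(y₀)`. The correction is chosen so that `A (χ y - y₀) = Φ y -
  -- Φ y₀` while `dχ(y₀)` is the identity: in the chart `χ`, the map `Φ` becomes affine.
  set χ : Y → Y := fun y => y + R (Φ y - Φ y₀ - A (y - y₀)) with hχ
  have hAχ : ∀ y, A (χ y - y₀) = Φ y - Φ y₀ := by
    intro y
    simp only [hχ, map_add, map_sub, hAR]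
    abel
  have hχs : ContDiffOn ℝ ∞ χ N :=
    contDiffOn_id.add (R.contDiff.comp_contDiffOn ((hΦ.sub contDiffOn_const).sub
      (A.contDiff.comp_contDiffOn (contDiffOn_id.sub contDiffOn_const))))
  have hNn : N ∈ 𝓝 y₀ := hN.mem_nhds hy₀
  have hΦ0 : HasFDerivAt Φ A y₀ :=
    ((hΦ.contDiffAt hNn).differentiableAt (by simp)).hasFDerivAt
  have hχ0 : HasFDerivAt χ ((ContinuousLinearEquiv.refl ℝ Y : Y ≃L[ℝ] Y) : Y →L[ℝ] Y) y₀ := by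
    have h1 : HasFDerivAt χ _ y₀ := (hasFDerivAt_id y₀).add
      (R.hasFDerivAt.comp y₀ (f := fun y => Φ y - Φ y₀ - A (y - y₀)) ((hΦ0.sub_const (Φ y₀)).sub
        (A.hasFDerivAt.comp y₀ ((hasFDerivAt_id y₀).sub_const y₀))))
    refine h1.congr_fderiv ?_
    ext v
    simp
  have hχy : χ y₀ = y₀ := by simp [hχ]
  have hχc : ContDiffAt ℝ ∞ χ y₀ := hχs.contDiffAt hNn
  set e := hχc.toOpenPartialHomeomorph χ hχ0 (by simp) with he
  have hec : ∀ y, e y = χ y := fun y => rfl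
  have hsrc : y₀ ∈ e.source := hχc.mem_toOpenPartialHomeomorph_source hχ0 (by simp)
  have htgt : y₀ ∈ e.target := by
    have := e.map_source hsrc
    rwa [hec, hχy] at this
  have hsymm : e.symm y₀ = y₀ := by
    have := e.left_inv hsrc
    rwa [hec, hχy] at this
  set θ : Y → Y := fun y => e.symm y with hθ
  have hθc : Filter.Tendsto θ (𝓝 y₀) (𝓝 y₀) := by
    have := e.continuousAt_symm htgt
    rw [ContinuousAt, hsymm] at this
    exact this
  have hinv : ∀ᶠ y in 𝓝 y₀, fderiv ℝ χ y ∈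
      Set.range (fun L : Y ≃L[ℝ] Y => (L : Y →L[ℝ] Y)) := by
    have hcont : ContinuousAt (fderiv ℝ χ) y₀ :=
      (hχc.fderiv_right (m := ∞) (by simp)).continuousAt
    refine hcont.eventually ?_
    rw [hχ0.fderiv]
    exact ContinuousLinearEquiv.nhds _
  have hgood : ∀ᶠ w in 𝓝 y₀, w ∈ e.target ∧ θ w ∈ N ∧ fderiv ℝ χ (θ w) ∈
      Set.range (fun L : Y ≃L[ℝ] Y => (L : Y →L[ℝ] Y)) :=
    Filter.Eventually.and (e.open_target.mem_nhds htgt)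
      ((hθc.eventually hNn).and (hθc.eventually hinv))
  obtain ⟨r, hr, hball⟩ := Metric.eventually_nhds_iff_ball.1 hgood
  have hθs : ∀ w ∈ Metric.ball y₀ r, ContDiffAt ℝ ∞ θ w := by
    intro w hw
    obtain ⟨h1, h2, L, hL⟩ := hball w hw
    have h3 : ContDiffAt ℝ ∞ χ (θ w) := hχs.contDiffAt (hN.mem_nhds h2)
    refine e.contDiffAt_symm (f₀' := L) h1 ?_ h3
    change HasFDerivAt χ (L : Y →L[ℝ] Y) (θ w)
    rw [show (L : Y →L[ℝ] Y) = fderiv ℝ χ (θ w) from hL]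
    exact (h3.differentiableAt (by simp)).hasFDerivAt
  have hΦθ : ∀ w ∈ Metric.ball y₀ r, Φ (θ w) = Φ y₀ + A (w - y₀) := by
    intro w hw
    have h1 : χ (θ w) = w := e.right_inv (hball w hw).1
    have h2 := hAχ (θ w)
    rw [h1] at h2
    rw [h2]
    abel
  have hhθ : ∀ w ∈ Metric.ball y₀ r, ContDiffAt ℝ ∞ (h ∘ θ) w := fun w hw =>
    (hh.contDiffAt (hN.mem_nhds (hball w hw).2.1)).comp w (hθs w hw)
  have hzero : ∀ w ∈ Metric.ball y₀ r, ∀ k, A k = 0 → fderiv ℝ (h ∘ θ) w k = 0 := by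
    intro w hw k hk
    have hn := hN.mem_nhds (hball w hw).2.1
    have hθd := ((hθs w hw).differentiableAt (by simp)).hasFDerivAt
    have h1 := ((hh.contDiffAt hn).differentiableAt (by simp)).hasFDerivAt.comp w hθd
    have h2 := ((hΦ.contDiffAt hn).differentiableAt (by simp)).hasFDerivAt.comp w hθd
    have h3 : HasFDerivAt (Φ ∘ θ) A w := by
      have h4 : HasFDerivAt (fun w => Φ y₀ + A (w - y₀)) A w := by
        simpa using (A.hasFDerivAt.comp w ((hasFDerivAt_id w).sub_const y₀)).const_add (Φ y₀)
      refine h4.congr_of_eventuallyEq ?_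
      filter_upwards [Metric.isOpen_ball.mem_nhds hw] with w' hw' using hΦθ w' hw'
    have h5 := congrArg (fun L => L k) (h2.unique h3)
    rw [h1.fderiv]
    exact hker _ (hball w hw).2.1 _ (by simpa [hk] using h5)
  -- In the straightened chart the fibres of `Φ` are slices of a convex ball by translates of `ker
  -- A`, so they are connected by segments along which `h ∘ θ` has zero derivative.
  have hconst : ∀ w ∈ Metric.ball y₀ r, ∀ w' ∈ Metric.ball y₀ r, A (w' - w) = 0 →
      h (θ w') = h (θ w) := by
    intro w hw w' hw' hk
    have hmem : ∀ s ∈ Set.Icc (0 : ℝ) 1, w + s • (w' - w) ∈ Metric.ball y₀ r := fun s hs =>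
      (convex_ball y₀ r).add_smul_sub_mem hw hw' hs
    have hd : ∀ s ∈ Set.Icc (0 : ℝ) 1,
        HasDerivAt (fun s : ℝ => (h ∘ θ) (w + s • (w' - w))) 0 s := by
      intro s hs
      have h1 : HasDerivAt (fun s : ℝ => w + s • (w' - w)) (w' - w) s := by
        simpa using ((hasDerivAt_id s).smul_const (w' - w)).const_add w
      have h2 := ((hhθ _ (hmem s hs)).differentiableAt (by simp)).hasFDerivAt.comp_hasDerivAt s h1
      rwa [hzero _ (hmem s hs) _ hk] at h2
    have h3 := constant_of_has_deriv_right_zero (fun s hs => (hd s hs).continuousAt.continuousWithinAt)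
      (fun s hs => (hd s ⟨hs.1, hs.2.le⟩).hasDerivWithinAt) 1 (by simp)
    simpa using h3
  -- `f` evaluates `h` on the section `c ↦ θ (y₀ + R (c - Φ y₀))` of `Φ`.
  refine ⟨fun c => h (θ (y₀ + R (c - Φ y₀))), (fun c => y₀ + R (c - Φ y₀)) ⁻¹' Metric.ball y₀ r,
    Metric.isOpen_ball.preimage (by fun_prop), by simpa using hr, ?_, ?_⟩
  · intro c hc
    refine ((hhθ _ hc).comp c (f := fun c => y₀ + R (c - Φ y₀)) ?_).contDiffWithinAt
    exact (contDiff_const.add (R.contDiff.comp (contDiff_id.sub contDiff_const))).contDiffAt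
  · have hc1 : Filter.Tendsto χ (𝓝 y₀) (𝓝 y₀) := by
      have := hχc.continuousAt
      rwa [ContinuousAt, hχy] at this
    have hc2 : Filter.Tendsto (fun y => y₀ + R (Φ y - Φ y₀)) (𝓝 y₀) (𝓝 y₀) := by
      have h1 : ContinuousAt (fun y => y₀ + R (Φ y - Φ y₀)) y₀ :=
        (R.continuous.continuousAt.comp (hΦ0.continuousAt.sub continuousAt_const)).const_add y₀
      simpa [ContinuousAt] using h1
    filter_upwards [hc1.eventually (Metric.ball_mem_nhds y₀ hr),
      hc2.eventually (Metric.ball_mem_nhds y₀ hr), e.open_source.mem_nhds hsrc] with y hy1 hy2 hy3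
    have h1 : θ (χ y) = y := e.left_inv hy3
    have h2 := hconst _ hy2 _ hy1 (by
      have h3 := hAχ y
      rw [map_sub] at h3
      simp only [map_sub, map_add, hAR]
      rw [sub_add_eq_sub_sub, h3, sub_self])
    rw [h1] at h2
    exact h2

/-- Linearly independent functionals are the components of a surjective map. -/
theorem surjective_of_linearIndependent_components {Y : Type*} [NormedAddCommGroup Y]
    [NormedSpace ℝ Y] {ι : Type*} [Fintype ι] (A : Y →L[ℝ] (ι → ℝ)) (a : ι → Y →L[ℝ] ℝ)
    (hA : ∀ v k, A v k = a k v) (ha : LinearIndependent ℝ a) : Function.Surjective A := by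
  classical
  by_contra hns
  have hlt : LinearMap.range (A : Y →ₗ[ℝ] (ι → ℝ)) < ⊤ :=
    lt_top_iff_ne_top.2 fun h => hns (LinearMap.range_eq_top.1 h)
  -- A nonzero functional that vanishes on a proper range is a linear relation between the
  -- components.
  obtain ⟨l, hl, hle⟩ := Submodule.exists_le_ker_of_lt_top _ hlt
  have hsum : ∑ k, l (Pi.single k 1) • a k = 0 := by
    ext v
    have h1 : l (A v) = 0 := hle ⟨v, rfl⟩
    rw [LinearMap.pi_apply_eq_sum_univ l (A v)] at h1
    simp only [sum_apply, smul_apply, zero_apply, smul_eq_mul]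
    rw [← h1]
    refine Finset.sum_congr rfl fun k _ => ?_
    rw [hA, smul_eq_mul, mul_comm]
    congr 2
    ext j
    simp [Pi.single_apply, eq_comm]
  have h0 := Fintype.linearIndependent_iff.1 ha _ hsum
  refine hl (LinearMap.pi_ext' fun k => LinearMap.ext_ring ?_)
  simpa using h0 k

/-! ### First integrals from an iterated Lie derivative. -/

/-- Let `Φ 0, Φ 1, …` be functions such that the field `S` kills `Φ 0` and maps `Φ (k + 1)` to
`Φ (k + 2)`. Then `∂_t + S` has a first integral that is locally a function of `t` and the
`Φ k`, and is independent of `Φ 0`. -/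
theorem exists_timeDependent_firstIntegral {Y : Type*} [NormedAddCommGroup Y] [NormedSpace ℝ Y]
    [FiniteDimensional ℝ Y] {N : Set Y} (hN : IsOpen N) (hne : N.Nonempty) (S : Y → Y)
    (Φ : ℕ → Y → ℝ) (hΦ : ∀ k, ContDiffOn ℝ ∞ (Φ k) N)
    (h0 : ∀ y ∈ N, fderiv ℝ (Φ 0) y (S y) = 0)
    (hsucc : ∀ k, ∀ y ∈ N, fderiv ℝ (Φ (k + 1)) y (S y) = Φ (k + 2) y)
    (hLI : ∀ y ∈ N, LinearIndependent ℝ ![fderiv ℝ (Φ 0) y, fderiv ℝ (Φ 1) y]) (t₀ : ℝ) :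
    ∃ y₀ ∈ N, ∃ G : ℝ × Y → ℝ, ∀ᶠ p in 𝓝 (t₀, y₀), ContDiffAt ℝ ∞ G p ∧
      fderiv ℝ G p (1, S p.2) = 0 ∧
      (∀ v, (∀ k, fderiv ℝ (Φ k) p.2 v = 0) → fderiv ℝ G p (0, v) = 0) ∧
      LinearIndependent ℝ ![fderiv ℝ (fun q : ℝ × Y => Φ 0 q.2) p, fderiv ℝ G p] := by
  classical
  have hd : ∀ k, ∀ y ∈ N, HasFDerivAt (Φ k) (fderiv ℝ (Φ k) y) y := fun k y hy =>
    (((hΦ k).contDiffAt (hN.mem_nhds hy)).differentiableAt (by simp)).hasFDerivAt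
  -- The number `m + 2` is the largest length of an initial segment independent at some point of
  -- `N`; it is finite because the dual of `Y` is finite-dimensional. Independence persists near
  -- `y₀`, while one more differential is dependent everywhere on `N`. The point `y₀` is produced
  -- here and cannot be prescribed.
  obtain ⟨m, ⟨y₀, hy₀, hind⟩, hmax⟩ : ∃ m : ℕ,
      (∃ y ∈ N, LinearIndependent ℝ (fun k : Fin (m + 2) => fderiv ℝ (Φ k) y)) ∧
      ¬ ∃ y ∈ N, LinearIndependent ℝ (fun k : Fin (m + 2 + 1) => fderiv ℝ (Φ k) y) := by
    by_contra! H
    have hall : ∀ m : ℕ,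
        ∃ y ∈ N, LinearIndependent ℝ (fun k : Fin (m + 2) => fderiv ℝ (Φ k) y) := by
      intro m
      induction m with
      | zero =>
        obtain ⟨y, hy⟩ := hne
        refine ⟨y, hy, ?_⟩
        convert hLI y hy using 1
        ext k : 1
        fin_cases k <;> rfl
      | succ m ih => exact H m ih
    obtain ⟨y, -, hy⟩ := hall (Module.finrank ℝ (Y →L[ℝ] ℝ))
    have := hy.fintype_card_le_finrank
    simp at this
  set M := m + 2 with hM
  set Ψ : Y → Fin M → ℝ := fun y k => Φ k y with hΨ
  have hΨs : ContDiffOn ℝ ∞ Ψ N := contDiffOn_pi.2 fun k => hΦ k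
  have hΨd : ∀ y ∈ N, ∀ v k, fderiv ℝ Ψ y v k = fderiv ℝ (Φ k) y v := by
    intro y hy v k
    have h1 : HasFDerivAt Ψ (ContinuousLinearMap.pi fun k : Fin M => fderiv ℝ (Φ k) y) y :=
      hasFDerivAt_pi.2 fun k => hd k y hy
    rw [h1.fderiv]
    rfl
  have hopen : ∀ᶠ y in 𝓝 y₀, LinearIndependent ℝ (fun k : Fin M => fderiv ℝ (Φ k) y) := by
    have hc : ContinuousAt (fun y => fun k : Fin M => fderiv ℝ (Φ k) y) y₀ :=
      continuousAt_pi.2 fun k =>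
        (((hΦ k).contDiffAt (hN.mem_nhds hy₀)).fderiv_right (m := ∞) (by simp)).continuousAt
    exact hc.eventually hind.eventually
  obtain ⟨N', hN'sub, hN'o, hy₀'⟩ := eventually_nhds_iff.1 (hopen.and (hN.mem_nhds hy₀))
  have hN'N : N' ⊆ N := fun y hy => (hN'sub y hy).2
  obtain ⟨f, Ω, hΩ, hcΩ, hf, hfe⟩ := exists_eventuallyEq_comp_of_ker_le hN'o (hΨs.mono hN'N)
    ((hΦ M).mono hN'N) hy₀'
    (surjective_of_linearIndependent_components _ _ (hΨd y₀ hy₀) hind) (by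
      intro y hy v hv
      have hspan : fderiv ℝ (Φ M) y ∈
          Submodule.span ℝ (Set.range fun k : Fin M => fderiv ℝ (Φ k) y) := by
        by_contra hnot
        refine hmax ⟨y, hN'N hy, ?_⟩
        have h1 := (hN'sub y hy).1.finSnoc hnot
        have h2 : (fun k : Fin (M + 1) => fderiv ℝ (Φ k) y) =
            Fin.snoc (fun k : Fin M => fderiv ℝ (Φ k) y) (fderiv ℝ (Φ M) y) := by
          ext k : 1
          refine Fin.lastCases ?_ (fun k => ?_) k
          · simp
          · simp
        rw [← h2] at h1
        exact h1
      have h2 : Submodule.span ℝ (Set.range fun k : Fin M => fderiv ℝ (Φ k) y) ≤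
          LinearMap.ker (ContinuousLinearMap.apply ℝ ℝ v : (Y →L[ℝ] ℝ) →ₗ[ℝ] ℝ) := by
        rw [Submodule.span_le]
        rintro _ ⟨k, rfl⟩
        have h3 := hΨd y (hN'N hy) v k
        rw [hv] at h3
        simpa using h3.symm
      simpa using h2 hspan)
  -- The field induced by `S` on the values `c` of `Φ 0, …, Φ (M - 1)`: the first is constant, the
  -- others shift, and the last is closed up by `Φ M = f (Φ 0, …, Φ (M - 1))`.
  set W : (Fin M → ℝ) → Fin M → ℝ := fun c k =>
    if k.val = 0 then 0 else if hk : k.val + 1 < M then c ⟨k.val + 1, hk⟩ else f c with hW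
  have hWs : ContDiffOn ℝ ∞ W Ω := by
    refine contDiffOn_pi.2 fun k => ?_
    simp only [hW]
    split_ifs
    · exact contDiffOn_const
    · exact (contDiff_apply ℝ ℝ _).contDiffOn
    · exact hf
  obtain ⟨ψ, hψ0, hψ⟩ := exists_firstIntegral hΩ hWs hcΩ
  let one : Fin M := ⟨1, by omega⟩
  set G : ℝ × Y → ℝ := fun p => ψ (p.1 - t₀, Ψ p.2) one with hG
  set θ : ℝ × Y → ℝ × (Fin M → ℝ) := fun p => (p.1 - t₀, Ψ p.2) with hθ
  have hθd : ∀ p : ℝ × Y, p.2 ∈ N → HasFDerivAt θ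
      (((ContinuousLinearMap.fst ℝ ℝ Y)).prod (fderiv ℝ Ψ p.2 ∘L .snd ℝ ℝ Y)) p := by
    intro p hp
    have h1 : HasFDerivAt Ψ (fderiv ℝ Ψ p.2) p.2 :=
      ((hΨs.contDiffAt (hN.mem_nhds hp)).differentiableAt (by simp)).hasFDerivAt
    exact (hasFDerivAt_fst.sub_const t₀).prodMk (h1.comp p hasFDerivAt_snd)
  have hθt : Filter.Tendsto θ (𝓝 (t₀, y₀)) (𝓝 (0, Ψ y₀)) := by
    have := (hθd (t₀, y₀) hy₀).continuousAt
    simpa [ContinuousAt, hθ] using this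
  have hnear : ∀ᶠ p : ℝ × Y in 𝓝 (t₀, y₀), p.2 ∈ N ∧ Φ M p.2 = f (Ψ p.2) ∧
      ContDiffAt ℝ ∞ ψ (θ p) ∧ fderiv ℝ ψ (θ p) (1, W (Ψ p.2)) = 0 := by
    have hs : Filter.Tendsto (fun p : ℝ × Y => p.2) (𝓝 (t₀, y₀)) (𝓝 y₀) :=
      continuous_snd.tendsto _
    exact (hs.eventually (hN.mem_nhds hy₀)).and ((hs.eventually hfe).and (hθt.eventually hψ))
  have hGs : ∀ᶠ p in 𝓝 (t₀, y₀), ContDiffAt ℝ ∞ G p := by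
    filter_upwards [hnear] with p hp
    have h1 : ContDiffAt ℝ ∞ θ p := (contDiffAt_fst.sub contDiffAt_const).prodMk
      ((hΨs.contDiffAt (hN.mem_nhds hp.1)).comp p contDiffAt_snd)
    exact (contDiff_apply ℝ ℝ one).contDiffAt.comp p (hp.2.2.1.comp p h1)
  have hGd : ∀ᶠ p in 𝓝 (t₀, y₀), ∀ a v,
      fderiv ℝ G p (a, v) = fderiv ℝ ψ (θ p) (a, fderiv ℝ Ψ p.2 v) one := by
    filter_upwards [hnear] with p hp a v
    have h1 : HasFDerivAt (ψ ∘ θ) _ p := HasFDerivAt.comp p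
      (hp.2.2.1.differentiableAt (by simp)).hasFDerivAt (hθd p hp.1)
    have h2 : HasFDerivAt G _ p := hasFDerivAt_pi'.1 h1 one
    rw [h2.fderiv]
    rfl
  have h0d : ∀ y ∈ N, ∀ t, HasFDerivAt (fun q : ℝ × Y => Φ 0 q.2)
      (fderiv ℝ (Φ 0) y ∘L .snd ℝ ℝ Y) (t, y) := fun y hy t =>
    HasFDerivAt.comp (t, y) (hd 0 y hy) hasFDerivAt_snd
  have hLI₀ : LinearIndependent ℝ
      ![fderiv ℝ (fun q : ℝ × Y => Φ 0 q.2) (t₀, y₀), fderiv ℝ G (t₀, y₀)] := by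
    -- Since `ψ (0, c) = c`, the function `G` restricts to `Φ 1` at time `t₀`, so independence from
    -- `Φ 0` is inherited there and then persists nearby.
    have h1 : fderiv ℝ G (t₀, y₀) ∘L .inr ℝ ℝ Y = fderiv ℝ (Φ 1) y₀ := by
      have h2 : HasFDerivAt (fun y => G (t₀, y)) (fderiv ℝ G (t₀, y₀) ∘L .inr ℝ ℝ Y) y₀ :=
        (hGs.self_of_nhds.differentiableAt (by simp)).hasFDerivAt.comp y₀
          (hasFDerivAt_prodMk_right t₀ y₀)
      rw [← h2.fderiv]
      congr 1
      ext y
      change ψ (t₀ - t₀, Ψ y) one = Φ 1 y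
      rw [sub_self, hψ0]
    have h3 := hLI y₀ hy₀
    rw [LinearIndependent.pair_iff] at h3 ⊢
    intro s t hst
    refine h3 s t ?_
    rw [(h0d y₀ hy₀ t₀).fderiv] at hst
    rw [← h1]
    ext v
    simpa using congrArg (fun L => L ((0 : ℝ), v)) hst
  have hLI' : ∀ᶠ p in 𝓝 (t₀, y₀),
      LinearIndependent ℝ ![fderiv ℝ (fun q : ℝ × Y => Φ 0 q.2) p, fderiv ℝ G p] := by
    have hc : ContinuousAt (fun p => ![fderiv ℝ (fun q : ℝ × Y => Φ 0 q.2) p, fderiv ℝ G p])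
        (t₀, y₀) := by
      refine continuousAt_pi.2 fun k => ?_
      fin_cases k
      · exact ((((hΦ 0).contDiffAt (hN.mem_nhds hy₀)).comp (t₀, y₀)
          contDiffAt_snd).fderiv_right (m := ∞) (by simp)).continuousAt
      · exact (hGs.self_of_nhds.fderiv_right (m := ∞) (by simp)).continuousAt
    exact hc.eventually hLI₀.eventually
  refine ⟨y₀, hy₀, G, ?_⟩
  filter_upwards [hnear, hGs, hGd, hLI'] with p hp hGsp hGdp hLIp
  refine ⟨hGsp, ?_, fun v hv => ?_, hLIp⟩
  · have h1 : fderiv ℝ Ψ p.2 (S p.2) = W (Ψ p.2) := by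
      ext k
      rw [hΨd p.2 hp.1]
      obtain ⟨k, hk⟩ := k
      cases k with
      | zero => simpa [hW] using h0 p.2 hp.1
      | succ k =>
        change fderiv ℝ (Φ (k + 1)) p.2 (S p.2) = _
        rw [hsucc k p.2 hp.1]
        simp only [hW]
        rw [if_neg (by omega)]
        by_cases h3 : k + 1 + 1 < M
        · rw [dif_pos h3]
        · rw [dif_neg h3, ← hp.2.1]
          congr 1
          omega
    rw [hGdp, h1, hp.2.2.2]
    rfl
  · have h1 : fderiv ℝ Ψ p.2 v = 0 := by
      ext k
      rw [hΨd p.2 hp.1, hv]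
      rfl
    rw [hGdp, h1, Prod.mk_zero_zero, map_zero]
    rfl

/-! ### Truncated jets and the total derivative. -/

section Jets

variable {n p : ℕ}

/-- The jets over `U`, without the coordinates `x` and `t`. -/
def fiberOver (p : ℕ) {n : ℕ} (U : Set (Fin n → ℝ)) : Set (JetFiber n p) := {q | q 0 ∈ U}

theorem isOpen_fiberOver {U : Set (Fin n → ℝ)} (hU : IsOpen U) : IsOpen (fiberOver p U) :=
  hU.preimage (continuous_apply 0)

/-- The coordinate vector `∂ / ∂u^k_m`, zero when `m > p`. -/
def jetVec {n : ℕ} (p m : ℕ) (k : Fin n) : JetFiber n p :=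
  fun r j => if r.val = m ∧ j = k then 1 else 0

theorem jetVec_eq_zero {m : ℕ} (h : p < m) (k : Fin n) : jetVec p m k = 0 := by
  ext r j
  have : r.val ≠ m := by omega
  simp [jetVec, this]

theorem jetVec_apply_zero (m : ℕ) (k : Fin n) :
    jetVec p m k 0 = if m = 0 then Pi.single k 1 else 0 := by
  ext j
  by_cases hm : m = 0
  · simp [jetVec, hm, Pi.single_apply]
  · simp [jetVec, hm, Ne.symm hm]

theorem jetCoord_jetVec {r m : ℕ} (hr : r ≤ p) (j k : Fin n) :
    jetCoord r j (jetVec p m k) = if r = m ∧ j = k then 1 else 0 := by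
  simp [jetCoord, jetVec, Nat.lt_succ_of_le hr]

theorem jetCoord_of_lt {r : ℕ} (hr : p < r) (j : Fin n) (q : JetFiber n p) :
    jetCoord r j q = 0 := by
  simp [jetCoord, Nat.not_lt.2 (Nat.succ_le_of_lt hr)]

/-- `jetCoord` as a continuous linear map. -/
noncomputable def jetCoordCLM (p r : ℕ) (j : Fin n) : JetFiber n p →L[ℝ] ℝ :=
  LinearMap.toContinuousLinearMap
    { toFun := fun q => jetCoord r j q
      map_add' := fun a b => by unfold jetCoord; split_ifs <;> simp
      map_smul' := fun c a => by unfold jetCoord; split_ifs <;> simp }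

@[simp] theorem jetCoordCLM_apply (r : ℕ) (j : Fin n) (q : JetFiber n p) :
    jetCoordCLM p r j q = jetCoord r j q := rfl

/-- The vector field of the total derivative. -/
noncomputable def totalField (n p : ℕ) : JetFiber n p →L[ℝ] JetFiber n p :=
  ContinuousLinearMap.pi fun r => ContinuousLinearMap.pi fun k => jetCoordCLM p (r.val + 1) k

theorem totalField_apply (q : JetFiber n p) (r : Fin (p + 1)) (k : Fin n) :
    totalField n p q r k = jetCoord (r.val + 1) k q := rfl

theorem totalDeriv_apply (G : JetFiber n p → ℝ) (q : JetFiber n p) :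
    totalDeriv G q = fderiv ℝ G q (totalField n p q) := rfl

/-- With `fderiv_totalDeriv_apply` this is the rule [∂/∂u^k_{m+1}, D_x] = ∂/∂u^k_m, valid in spite
of the truncation. -/
theorem totalField_jetVec_succ {m : ℕ} (hm : m < p) (k : Fin n) :
    totalField n p (jetVec p (m + 1) k) = jetVec p m k := by
  ext r j
  rw [totalField_apply]
  by_cases hr : r.val + 1 ≤ p
  · rw [jetCoord_jetVec hr]
    simp [jetVec]
  · rw [jetCoord_of_lt (by omega)]
    have : r.val ≠ m := by omega
    simp [jetVec, this]

variable {U : Set (Fin n → ℝ)} {f g : JetFiber n p → ℝ} {q : JetFiber n p}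

theorem totalDeriv_congr (hU : IsOpen U) (h : Set.EqOn f g (fiberOver p U)) :
    Set.EqOn (totalDeriv f) (totalDeriv g) (fiberOver p U) := fun q hq => by
  rw [totalDeriv_apply, totalDeriv_apply,
    (h.eventuallyEq_of_mem ((isOpen_fiberOver hU).mem_nhds hq)).fderiv_eq]

theorem iterate_totalDeriv_congr (hU : IsOpen U) (h : Set.EqOn f g (fiberOver p U)) (s : ℕ) :
    Set.EqOn (totalDeriv^[s] f) (totalDeriv^[s] g) (fiberOver p U) := by
  induction s with
  | zero => exact h
  | succ s ih =>
    rw [Function.iterate_succ_apply', Function.iterate_succ_apply']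
    exact totalDeriv_congr hU ih

theorem contDiffOn_fderiv_apply {E F : Type*} [NormedAddCommGroup E] [NormedSpace ℝ E]
    [NormedAddCommGroup F] [NormedSpace ℝ F] {f : E → F} {X : E → E} {V : Set E} (hV : IsOpen V)
    (hf : ContDiffOn ℝ ∞ f V) (hX : ContDiffOn ℝ ∞ X V) :
    ContDiffOn ℝ ∞ (fun q => fderiv ℝ f q (X q)) V :=
  (hf.fderiv_of_isOpen (m := ∞) hV (by simp)).clm_apply hX

theorem contDiffOn_totalDeriv (hU : IsOpen U) (hf : ContDiffOn ℝ ∞ f (fiberOver p U)) :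
    ContDiffOn ℝ ∞ (totalDeriv f) (fiberOver p U) :=
  contDiffOn_fderiv_apply (isOpen_fiberOver hU) hf (totalField n p).contDiff.contDiffOn

theorem contDiffOn_iterate_totalDeriv (hU : IsOpen U) (hf : ContDiffOn ℝ ∞ f (fiberOver p U))
    (s : ℕ) : ContDiffOn ℝ ∞ (totalDeriv^[s] f) (fiberOver p U) := by
  induction s with
  | zero => exact hf
  | succ s ih =>
    rw [Function.iterate_succ_apply']
    exact contDiffOn_totalDeriv hU ih

/-- The commutator of two derivations, for fields and functions smooth on an open set. -/
theorem fderiv_commutator {E : Type*} [NormedAddCommGroup E] [NormedSpace ℝ E]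
    {f : E → ℝ} {X Z : E → E} {V : Set E} (hV : IsOpen V)
    (hf : ContDiffOn ℝ ∞ f V) (hX : ContDiffOn ℝ ∞ X V) (hZ : ContDiffOn ℝ ∞ Z V) {x : E}
    (hx : x ∈ V) :
    fderiv ℝ (fun y => fderiv ℝ f y (Z y)) x (X x) =
      fderiv ℝ (fun y => fderiv ℝ f y (X y)) x (Z x) +
        fderiv ℝ f x (fderiv ℝ Z x (X x) - fderiv ℝ X x (Z x)) := by
  have hn := hV.mem_nhds hx
  have h := VectorField.fderiv_apply_lieBracket (𝕜 := ℝ) (V := X) (W := Z) (n := 2)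
    (contDiffAt_infty.1 (hf.contDiffAt hn) 2) (by simp)
    ((hZ.contDiffAt hn).differentiableAt (by simp))
    ((hX.contDiffAt hn).differentiableAt (by simp))
  rw [VectorField.lieBracket] at h
  rw [h]
  ring

/-- The field D_x has linear coefficients, so its bracket with a constant field `v` is the constant
field `totalField n p v`. -/
theorem fderiv_totalDeriv_apply (hU : IsOpen U) (hf : ContDiffOn ℝ ∞ f (fiberOver p U))
    (hq : q ∈ fiberOver p U) (v : JetFiber n p) :
    fderiv ℝ (totalDeriv f) q v =
      totalDeriv (fun y => fderiv ℝ f y v) q + fderiv ℝ f q (totalField n p v) := by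
  have := fderiv_commutator (isOpen_fiberOver hU) hf (contDiffOn_const (c := v))
    (totalField n p).contDiff.contDiffOn hq
  rw [ContinuousLinearMap.fderiv, fderiv_const_apply, zero_apply, sub_zero] at this
  exact this

theorem totalDeriv_eq_zero (hU : IsOpen U) (h : ∀ q ∈ fiberOver p U, f q = 0)
    (hq : q ∈ fiberOver p U) : totalDeriv f q = 0 := by
  rw [totalDeriv_congr (g := fun _ => 0) hU h hq, totalDeriv_apply, fderiv_const_apply]
  rfl

/-- If `f` does not depend on `u^k_m` for `m > r`, then `D_x^s f` does not depend on `u^k_m` for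
`m > r + s`, and its derivative in `u^k_{r+s}` is that of `f` in `u^k_r`. -/
theorem fderiv_iterate_totalDeriv_jetVec (hU : IsOpen U) (hf : ContDiffOn ℝ ∞ f (fiberOver p U))
    {r : ℕ} {k : Fin n} (h : ∀ m > r, ∀ q ∈ fiberOver p U, fderiv ℝ f q (jetVec p m k) = 0)
    (s : ℕ) :
    (∀ m > r + s, ∀ q ∈ fiberOver p U, fderiv ℝ (totalDeriv^[s] f) q (jetVec p m k) = 0) ∧
      (r + s ≤ p → ∀ q ∈ fiberOver p U,
        fderiv ℝ (totalDeriv^[s] f) q (jetVec p (r + s) k) = fderiv ℝ f q (jetVec p r k)) := by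
  induction s with
  | zero => exact ⟨h, fun _ q _ => rfl⟩
  | succ s ih =>
    rw [Function.iterate_succ_apply']
    have hs := contDiffOn_iterate_totalDeriv hU hf s
    refine ⟨fun m hm q hq => ?_, fun hp q hq => ?_⟩
    · by_cases hmp : p < m
      · rw [jetVec_eq_zero hmp, map_zero]
      · obtain ⟨m, rfl⟩ : ∃ m', m = m' + 1 := ⟨m - 1, by omega⟩
        rw [fderiv_totalDeriv_apply hU hs hq, totalField_jetVec_succ (by omega),
          ih.1 m (by omega) q hq, totalDeriv_eq_zero hU (ih.1 (m + 1) (by omega)) hq, add_zero]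
    · rw [← add_assoc, fderiv_totalDeriv_apply hU hs hq, totalField_jetVec_succ (by omega),
        ih.2 (by omega) q hq, totalDeriv_eq_zero hU (ih.1 (r + s + 1) (by omega)) hq, zero_add]

end Jets

/-! ### The evolutionary field and its truncation error. -/

section Flow

variable {n p : ℕ} {U : Set (Fin n → ℝ)} {lam mu : (Fin n → ℝ) → Fin n → ℝ}

/-- The right-hand side `lam^j u^j_x` of the system. -/
noncomputable def flux (p : ℕ) (lam : (Fin n → ℝ) → Fin n → ℝ) (j : Fin n) (q : JetFiber n p) : ℝ :=
  lam (q 0) j * jetCoord 1 j q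

theorem timeDeriv_eq_iterate (r : ℕ) (j : Fin n) :
    (timeDeriv lam r j : JetFiber n p → ℝ) = totalDeriv^[r] (flux p lam j) := rfl

theorem timeDeriv_succ (r : ℕ) (j : Fin n) :
    (timeDeriv lam (r + 1) j : JetFiber n p → ℝ) = totalDeriv (timeDeriv lam r j) := by
  rw [timeDeriv_eq_iterate, Function.iterate_succ_apply']
  rfl

theorem contDiffOn_speed (hlam : ContDiffOn ℝ ∞ lam U) (i : Fin n) :
    ContDiffOn ℝ ∞ (fun q : JetFiber n p => lam (q 0) i) (fiberOver p U) :=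
  (contDiffOn_pi.1 hlam i).comp (contDiff_apply ℝ (Fin n → ℝ) (0 : Fin (p + 1))).contDiffOn
    (fun _ hq => hq)

theorem hasFDerivAt_speed (hU : IsOpen U) (hlam : ContDiffOn ℝ ∞ lam U) (i : Fin n)
    {q : JetFiber n p} (hq : q ∈ fiberOver p U) :
    HasFDerivAt (fun q : JetFiber n p => lam (q 0) i)
      (fderiv ℝ (fun w => lam w i) (q 0) ∘L ContinuousLinearMap.proj 0) q :=
  HasFDerivAt.comp q (f := fun q : JetFiber n p => q 0)
    ((((contDiffOn_pi.1 hlam i).contDiffAt (hU.mem_nhds hq)).differentiableAt (by simp)).hasFDerivAt)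
    (ContinuousLinearMap.proj (R := ℝ) (φ := fun _ : Fin (p + 1) => Fin n → ℝ) 0).hasFDerivAt

theorem fderiv_speed (hU : IsOpen U) (hlam : ContDiffOn ℝ ∞ lam U) (i : Fin n)
    {q : JetFiber n p} (hq : q ∈ fiberOver p U) (v : JetFiber n p) :
    fderiv ℝ (fun q : JetFiber n p => lam (q 0) i) q v =
      ∑ k, partialDeriv lam i k (q 0) * v 0 k := by
  rw [(hasFDerivAt_speed hU hlam i hq).fderiv]
  change fderiv ℝ (fun w => lam w i) (q 0) (v 0) = _
  have := LinearMap.pi_apply_eq_sum_univ (fderiv ℝ (fun w => lam w i) (q 0) : _ →ₗ[ℝ] ℝ) (v 0)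
  refine this.trans (Finset.sum_congr rfl fun k _ => ?_)
  have hs : (fun j => if k = j then (1 : ℝ) else 0) = Pi.single k 1 := by
    ext j
    simp [Pi.single_apply, eq_comm]
  rw [hs, smul_eq_mul, mul_comm]
  rfl

theorem contDiffOn_flux (hlam : ContDiffOn ℝ ∞ lam U) (j : Fin n) :
    ContDiffOn ℝ ∞ (flux p lam j) (fiberOver p U) :=
  (contDiffOn_speed hlam j).mul (jetCoordCLM p 1 j).contDiff.contDiffOn

theorem contDiffOn_timeDeriv (hU : IsOpen U) (hlam : ContDiffOn ℝ ∞ lam U) (r : ℕ) (j : Fin n) :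
    ContDiffOn ℝ ∞ (timeDeriv lam r j) (fiberOver p U) :=
  contDiffOn_iterate_totalDeriv hU (contDiffOn_flux hlam j) r

theorem fderiv_speed_mul_jetCoord (hU : IsOpen U) (hlam : ContDiffOn ℝ ∞ lam U) (i j : Fin n)
    (r : ℕ) {q : JetFiber n p} (hq : q ∈ fiberOver p U) (v : JetFiber n p) :
    fderiv ℝ (fun q : JetFiber n p => lam (q 0) i * jetCoord r j q) q v =
      (∑ k, partialDeriv lam i k (q 0) * v 0 k) * jetCoord r j q +
        lam (q 0) i * jetCoord r j v := by
  have h1 : HasFDerivAt (fun q : JetFiber n p => lam (q 0) i)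
      (fderiv ℝ (fun q : JetFiber n p => lam (q 0) i) q) q :=
    (hasFDerivAt_speed hU hlam i hq).differentiableAt.hasFDerivAt
  have h2 := h1.mul (jetCoordCLM p r j).hasFDerivAt
  have h3 : fderiv ℝ (fun q : JetFiber n p => lam (q 0) i * jetCoord r j q) q = _ := h2.fderiv
  rw [h3, ← fderiv_speed hU hlam i hq v]
  simp
  ring

theorem sum_partialDeriv_mul_jetVec (i k : Fin n) (m : ℕ) (u : Fin n → ℝ) :
    ∑ l, partialDeriv lam i l u * jetVec p m k 0 l = if m = 0 then partialDeriv lam i k u else 0 := by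
  rw [jetVec_apply_zero]
  by_cases hm : m = 0
  · simp [hm, Pi.single_apply]
  · simp [hm]

theorem fderiv_flux_jetVec (hU : IsOpen U) (hlam : ContDiffOn ℝ ∞ lam U) (j k : Fin n) (m : ℕ)
    {q : JetFiber n p} (hq : q ∈ fiberOver p U) :
    fderiv ℝ (flux p lam j) q (jetVec p m k) =
      (if m = 0 then partialDeriv lam j k (q 0) else 0) * jetCoord 1 j q +
        lam (q 0) j * jetCoord 1 j (jetVec p m k) := by
  rw [← sum_partialDeriv_mul_jetVec]
  exact fderiv_speed_mul_jetCoord hU hlam j j 1 hq _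

theorem fderiv_flux_jetVec_of_one_lt (hU : IsOpen U) (hlam : ContDiffOn ℝ ∞ lam U) (j k : Fin n) :
    ∀ m > 1, ∀ q ∈ fiberOver p U, fderiv ℝ (flux p lam j) q (jetVec p m k) = 0 := by
  intro m hm q hq
  rw [fderiv_flux_jetVec hU hlam j k m hq, if_neg (by omega), zero_mul, zero_add]
  by_cases hp : 1 ≤ p
  · rw [jetCoord_jetVec hp, if_neg (by omega), mul_zero]
  · rw [jetCoord_of_lt (by omega), mul_zero]

theorem fderiv_flux_jetVec_of_ne (hU : IsOpen U) (hlam : ContDiffOn ℝ ∞ lam U) {j k : Fin n}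
    (hjk : j ≠ k) :
    ∀ m > 0, ∀ q ∈ fiberOver p U, fderiv ℝ (flux p lam j) q (jetVec p m k) = 0 := by
  intro m hm q hq
  rw [fderiv_flux_jetVec hU hlam j k m hq, if_neg (by omega), zero_mul, zero_add]
  by_cases hp : 1 ≤ p
  · rw [jetCoord_jetVec hp, if_neg (by tauto), mul_zero]
  · rw [jetCoord_of_lt (by omega), mul_zero]

/-- `D_x^s (lam^j u^j_x)` has order at most `s + 1`. -/
theorem fderiv_timeDeriv_jetVec_eq_zero (hU : IsOpen U) (hlam : ContDiffOn ℝ ∞ lam U)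
    {s m : ℕ} (hm : s + 1 < m) (j k : Fin n) {q : JetFiber n p} (hq : q ∈ fiberOver p U) :
    fderiv ℝ (timeDeriv lam s j) q (jetVec p m k) = 0 :=
  (fderiv_iterate_totalDeriv_jetVec hU (contDiffOn_flux hlam j)
    (fderiv_flux_jetVec_of_one_lt hU hlam j k) s).1 m (by omega) q hq

theorem fderiv_timeDeriv_jetVec_succ (hU : IsOpen U) (hlam : ContDiffOn ℝ ∞ lam U)
    {s : ℕ} (hs : s + 1 ≤ p) (j k : Fin n) {q : JetFiber n p} (hq : q ∈ fiberOver p U) :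
    fderiv ℝ (timeDeriv lam s j) q (jetVec p (s + 1) k) = if j = k then lam (q 0) j else 0 := by
  have h := (fderiv_iterate_totalDeriv_jetVec hU (contDiffOn_flux (p := p) hlam j)
    (fderiv_flux_jetVec_of_one_lt hU hlam j k) s).2 (by omega) q hq
  rw [add_comm 1 s] at h
  rw [timeDeriv_eq_iterate, h, fderiv_flux_jetVec hU hlam j k 1 hq,
    jetCoord_jetVec (by omega)]
  simp

/-- For `k ≠ j` the flux λ^j u^j_x involves u^k only at order zero, so the leading coefficient is
carried from order `0` to order `s` instead of from `1` to `s + 1`. -/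
theorem fderiv_timeDeriv_jetVec_self (hU : IsOpen U) (hlam : ContDiffOn ℝ ∞ lam U)
    {s : ℕ} (hs : s ≤ p) {j k : Fin n} (hjk : j ≠ k) {q : JetFiber n p} (hq : q ∈ fiberOver p U) :
    fderiv ℝ (timeDeriv lam s j) q (jetVec p s k) =
      partialDeriv lam j k (q 0) * jetCoord 1 j q := by
  have h := (fderiv_iterate_totalDeriv_jetVec hU (contDiffOn_flux (p := p) hlam j)
    (fderiv_flux_jetVec_of_ne hU hlam hjk) s).2 (by omega) q hq
  rw [zero_add] at h
  rw [timeDeriv_eq_iterate, h, fderiv_flux_jetVec hU hlam j k 0 hq]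
  by_cases hp : 1 ≤ p
  · rw [jetCoord_jetVec hp]
    simp
  · rw [jetCoord_of_lt (by omega), jetCoord_of_lt (by omega)]
    simp

/-- The evolutionary vector field of the system, on jets of order `p`. -/
noncomputable def evolField (p : ℕ) (lam : (Fin n → ℝ) → Fin n → ℝ) (q : JetFiber n p) :
    JetFiber n p := fun r j => timeDeriv lam r.val j q

theorem jetCoord_evolField {r : ℕ} (hr : r ≤ p) (j : Fin n) (q : JetFiber n p) :
    jetCoord r j (evolField p lam q) = timeDeriv lam r j q := by
  rw [jetCoord, dif_pos (Nat.lt_succ_of_le hr)]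
  rfl

theorem contDiffOn_evolField (hU : IsOpen U) (hlam : ContDiffOn ℝ ∞ lam U) :
    ContDiffOn ℝ ∞ (evolField p lam) (fiberOver p U) :=
  contDiffOn_pi.2 fun r => contDiffOn_pi.2 fun j => contDiffOn_timeDeriv hU hlam r.val j

theorem fderiv_apply_apply {E ι κ : Type*} [NormedAddCommGroup E] [NormedSpace ℝ E] [Fintype ι]
    [Fintype κ] {X : E → ι → κ → ℝ} {q : E} (hX : DifferentiableAt ℝ X q) (v : E) (r : ι) (j : κ) :
    fderiv ℝ X q v r j = fderiv ℝ (fun q => X q r j) q v := by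
  have h := hasFDerivAt_pi'.1 (hasFDerivAt_pi'.1 hX.hasFDerivAt r) j
  rw [h.fderiv]
  rfl

/-- Without truncation the evolutionary field commutes with D_x. With `u_{p+1} = 0` the only defect
is in the components of order `p`, where D_x of the evolutionary component is no longer matched. -/
theorem fderiv_totalDeriv_evolField (hU : IsOpen U) (hlam : ContDiffOn ℝ ∞ lam U)
    {f : JetFiber n p → ℝ} (hf : ContDiffOn ℝ ∞ f (fiberOver p U)) {q : JetFiber n p}
    (hq : q ∈ fiberOver p U) :
    fderiv ℝ (totalDeriv f) q (evolField p lam q) =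
      totalDeriv (fun y => fderiv ℝ f y (evolField p lam y)) q -
        ∑ k, timeDeriv lam (p + 1) k q * fderiv ℝ f q (jetVec p p k) := by
  have hE := contDiffOn_evolField (p := p) hU hlam
  have h := fderiv_commutator (isOpen_fiberOver hU) hf hE
    (totalField n p).contDiff.contDiffOn hq
  have hb : fderiv ℝ (totalField n p) q (evolField p lam q) -
      fderiv ℝ (evolField p lam) q (totalField n p q) =
      -∑ k, timeDeriv lam (p + 1) k q • jetVec p p k := by
    rw [ContinuousLinearMap.fderiv]
    ext r j
    simp only [Pi.sub_apply, Pi.neg_apply, Finset.sum_apply, Pi.smul_apply, smul_eq_mul]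
    rw [totalField_apply, fderiv_apply_apply ((hE.contDiffAt
      ((isOpen_fiberOver hU).mem_nhds hq)).differentiableAt (by simp))]
    change _ - totalDeriv (timeDeriv lam r.val j) q = _
    rw [← timeDeriv_succ]
    by_cases hr : r.val = p
    · rw [jetCoord_of_lt (by omega), hr]
      simp [jetVec, hr]
    · rw [jetCoord_evolField (by omega)]
      simp [jetVec, hr]
  change fderiv ℝ (totalDeriv f) q (evolField p lam q) = _ at h
  rw [h, hb, map_neg, map_sum, ← sub_eq_add_neg]
  simp only [map_smul, smul_eq_mul]
  rfl

/-- The evolutionary field of `lam` on `D_x^s (mu^j u^j_x)`, for `s < p`. -/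
theorem fderiv_timeDeriv_evolField_of_lt (hU : IsOpen U) (hlam : ContDiffOn ℝ ∞ lam U)
    (hmu : ContDiffOn ℝ ∞ mu U) (j : Fin n) {s : ℕ} (hs : s = 0 ∨ s < p) :
    Set.EqOn (fun q => fderiv ℝ (timeDeriv mu s j) q (evolField p lam q))
      (totalDeriv^[s] fun q => fderiv ℝ (flux p mu j) q (evolField p lam q)) (fiberOver p U) := by
  induction s with
  | zero => exact fun q _ => rfl
  | succ s ih =>
    intro q hq
    rw [Function.iterate_succ_apply']
    simp only [timeDeriv_succ]
    rw [fderiv_totalDeriv_evolField hU hlam (contDiffOn_timeDeriv hU hmu s j) hq,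
      totalDeriv_congr hU (ih (by omega)) hq, Finset.sum_eq_zero, sub_zero]
    -- The function differentiated has order at most `s + 1 < p`, so it does not see the defect at
    -- order `p`.
    intro k _
    rw [fderiv_timeDeriv_jetVec_eq_zero hU hmu (by omega) j k hq, mul_zero]

/-- The evolutionary field of `lam` on `D_x^p (mu^j u^j_x)`; the last term is due to the
truncation. -/
theorem fderiv_timeDeriv_evolField_self (hU : IsOpen U) (hlam : ContDiffOn ℝ ∞ lam U)
    (hmu : ContDiffOn ℝ ∞ mu U) (j : Fin n) (hp : 1 ≤ p) {q : JetFiber n p}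
    (hq : q ∈ fiberOver p U) :
    fderiv ℝ (timeDeriv mu p j) q (evolField p lam q) =
      totalDeriv^[p] (fun q => fderiv ℝ (flux p mu j) q (evolField p lam q)) q -
        mu (q 0) j * timeDeriv lam (p + 1) j q := by
  obtain ⟨s, rfl⟩ : ∃ s, p = s + 1 := ⟨p - 1, by omega⟩
  rw [Function.iterate_succ_apply', timeDeriv_succ,
    fderiv_totalDeriv_evolField hU hlam (contDiffOn_timeDeriv hU hmu s j) hq,
    totalDeriv_congr hU (fderiv_timeDeriv_evolField_of_lt hU hlam hmu j (by omega)) hq]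
  congr 1
  -- Here `D_x^s (mu^j u^j_x)` has order `s + 1 = p`, and among the `u^k_p` it contains only
  -- `u^j_p`, with coefficient `mu^j`.
  rw [Finset.sum_eq_single j]
  · rw [fderiv_timeDeriv_jetVec_succ hU hmu le_rfl j j hq, if_pos rfl, mul_comm]
  · intro k _ hk
    rw [fderiv_timeDeriv_jetVec_succ hU hmu le_rfl j k hq, if_neg (Ne.symm hk), mul_zero]
  · simp

end Flow

/-! ### Commutation of the two flows and of their characteristic fields. -/

section CommutingFlow

variable {n p : ℕ} {U : Set (Fin n → ℝ)} {lam mu : (Fin n → ℝ) → Fin n → ℝ}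

/-- Clearing denominators makes the relation symmetric in λ and μ and valid for `i = k`. Coinciding
components of μ do no harm in this form. -/
theorem SolvesCommutingSystemOn.cross_mul (hhyp : StrictlyHyperbolicOn lam U)
    (hcomm : SolvesCommutingSystemOn lam mu U) {u : Fin n → ℝ} (hu : u ∈ U) (i k : Fin n) :
    (lam u k - lam u i) * partialDeriv mu i k u = (mu u k - mu u i) * partialDeriv lam i k u := by
  by_cases hik : i = k
  · simp [hik]
  · have h : lam u k - lam u i ≠ 0 := sub_ne_zero.2 (hhyp u hu k i (Ne.symm hik))
    rw [hcomm u hu i k hik, aCoeff]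
    field_simp

theorem SolvesCommutingSystemOn.sum_eq (hhyp : StrictlyHyperbolicOn lam U)
    (hcomm : SolvesCommutingSystemOn lam mu U) {u : Fin n → ℝ} (hu : u ∈ U) (i : Fin n)
    (c : Fin n → ℝ) :
    ∑ k, partialDeriv mu i k u * (lam u k * c k - lam u i * c k) =
      ∑ k, partialDeriv lam i k u * (mu u k * c k - mu u i * c k) :=
  Finset.sum_congr rfl fun k _ => by
    linear_combination c k * hcomm.cross_mul hhyp hu i k

theorem totalDeriv_flux (hU : IsOpen U) (hlam : ContDiffOn ℝ ∞ lam U) (j : Fin n)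
    {q : JetFiber n p} (hq : q ∈ fiberOver p U) :
    totalDeriv (flux p lam j) q = (∑ k, partialDeriv lam j k (q 0) * jetCoord 1 k q) *
      jetCoord 1 j q + lam (q 0) j * jetCoord 1 j (totalField n p q) :=
  fderiv_speed_mul_jetCoord hU hlam j j 1 hq (totalField n p q)

theorem fderiv_flux_evolField (hU : IsOpen U) (hmu : ContDiffOn ℝ ∞ mu U)
    (j : Fin n) {q : JetFiber n p} (hq : q ∈ fiberOver p U) :
    fderiv ℝ (flux p mu j) q (evolField p lam q) =
      (∑ k, partialDeriv mu j k (q 0) * (lam (q 0) k * jetCoord 1 k q)) * jetCoord 1 j q +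
        mu (q 0) j * jetCoord 1 j (evolField p lam q) :=
  fderiv_speed_mul_jetCoord hU hmu j j 1 hq (evolField p lam q)

/-- The flows of `lam` and `mu` commute. -/
theorem fderiv_flux_evolField_comm (hU : IsOpen U) (hlam : ContDiffOn ℝ ∞ lam U)
    (hmu : ContDiffOn ℝ ∞ mu U) (hhyp : StrictlyHyperbolicOn lam U)
    (hcomm : SolvesCommutingSystemOn lam mu U) (j : Fin n) :
    Set.EqOn (fun q => fderiv ℝ (flux p mu j) q (evolField p lam q))
      (fun q => fderiv ℝ (flux p lam j) q (evolField p mu q)) (fiberOver p U) := by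
  intro q hq
  simp only [fderiv_flux_evolField hU hmu j hq, fderiv_flux_evolField hU hlam j hq]
  by_cases hp : 1 ≤ p
  · rw [jetCoord_evolField hp, jetCoord_evolField hp, timeDeriv_succ, timeDeriv_succ]
    have h := hcomm.sum_eq hhyp hq j (fun k => jetCoord 1 k q)
    simp only [mul_sub, Finset.sum_sub_distrib, mul_left_comm _ (lam (q 0) j),
      mul_left_comm _ (mu (q 0) j), ← Finset.mul_sum] at h
    have h1 := totalDeriv_flux (p := p) hU hlam j hq
    have h2 := totalDeriv_flux (p := p) hU hmu j hq
    change totalDeriv (timeDeriv lam 0 j) q = _ at h1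
    change totalDeriv (timeDeriv mu 0 j) q = _ at h2
    rw [h1, h2]
    linear_combination jetCoord 1 j q * h
  · rw [jetCoord_of_lt (by omega), jetCoord_of_lt (by omega), jetCoord_of_lt (by omega)]
    simp

/-- The components of order `0, …, p` of the field `∂_t - lam^i ∂_x` in the `i`-th Monge
distribution. -/
noncomputable def mongeField (p : ℕ) (lam : (Fin n → ℝ) → Fin n → ℝ) (i : Fin n)
    (q : JetFiber n p) : JetFiber n p :=
  evolField p lam q - lam (q 0) i • totalField n p q

theorem mongeField_apply (i : Fin n) (q : JetFiber n p) (r : Fin (p + 1)) (j : Fin n) :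
    mongeField p lam i q r j =
      timeDeriv lam r.val j q - lam (q 0) i * jetCoord (r.val + 1) j q := rfl

theorem mongeField_apply_zero (i : Fin n) (q : JetFiber n p) (j : Fin n) :
    mongeField p lam i q 0 j = lam (q 0) j * jetCoord 1 j q - lam (q 0) i * jetCoord 1 j q := rfl

theorem contDiffOn_mongeField (hU : IsOpen U) (hlam : ContDiffOn ℝ ∞ lam U) (i : Fin n) :
    ContDiffOn ℝ ∞ (mongeField p lam i) (fiberOver p U) :=
  (contDiffOn_evolField hU hlam).sub
    ((contDiffOn_speed hlam i).smul (totalField n p).contDiff.contDiffOn)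

theorem differentiableAt_mongeField (hU : IsOpen U) (hlam : ContDiffOn ℝ ∞ lam U) (i : Fin n)
    {q : JetFiber n p} (hq : q ∈ fiberOver p U) : DifferentiableAt ℝ (mongeField p lam i) q :=
  ((contDiffOn_mongeField hU hlam i).contDiffAt
    ((isOpen_fiberOver hU).mem_nhds hq)).differentiableAt (by simp)

theorem fderiv_mongeField_apply (hU : IsOpen U) (hlam : ContDiffOn ℝ ∞ lam U) (i : Fin n)
    {q : JetFiber n p} (hq : q ∈ fiberOver p U) (v : JetFiber n p) (r : Fin (p + 1)) (j : Fin n) :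
    fderiv ℝ (mongeField p lam i) q v r j = fderiv ℝ (timeDeriv lam r.val j) q v -
      ((∑ k, partialDeriv lam i k (q 0) * v 0 k) * jetCoord (r.val + 1) j q +
        lam (q 0) i * jetCoord (r.val + 1) j v) := by
  rw [fderiv_apply_apply (differentiableAt_mongeField hU hlam i hq),
    ← fderiv_speed_mul_jetCoord hU hlam i j _ hq]
  have hn := (isOpen_fiberOver (p := p) hU).mem_nhds hq
  have h1 := ((contDiffOn_timeDeriv hU hlam r.val j).contDiffAt hn).differentiableAt
    (by simp : (∞ : WithTop ℕ∞) ≠ 0)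
  have h2 := (((contDiffOn_speed hlam i).mul
    (jetCoordCLM p (r.val + 1) j).contDiff.contDiffOn).contDiffAt hn).differentiableAt
    (by simp : (∞ : WithTop ℕ∞) ≠ 0)
  have h3 := h1.hasFDerivAt.sub h2.hasFDerivAt
  have h4 : fderiv ℝ (fun q => mongeField p lam i q r j) q = _ := h3.fderiv
  rw [h4]
  rfl

/-- The fields `∂_t - lam^i ∂_x` and `∂_τ - mu^i ∂_x` commute, up to `∂ / ∂u^j_p`, `j ≠ i`. -/
theorem fderiv_mongeField_comm (hU : IsOpen U) (hlam : ContDiffOn ℝ ∞ lam U)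
    (hmu : ContDiffOn ℝ ∞ mu U) (hhyp : StrictlyHyperbolicOn lam U)
    (hcomm : SolvesCommutingSystemOn lam mu U) (i : Fin n) {q : JetFiber n p}
    (hq : q ∈ fiberOver p U) (r : Fin (p + 1)) (j : Fin n) (hrj : r.val < p ∨ j = i) :
    fderiv ℝ (mongeField p mu i) q (mongeField p lam i q) r j =
      fderiv ℝ (mongeField p lam i) q (mongeField p mu i q) r j := by
  have key : ∀ lam mu : (Fin n → ℝ) → Fin n → ℝ, fderiv ℝ (timeDeriv mu r.val j) q
      (mongeField p lam i q) = fderiv ℝ (timeDeriv mu r.val j) q (evolField p lam q) -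
        lam (q 0) i * timeDeriv mu (r.val + 1) j q := by
    intro lam mu
    rw [timeDeriv_succ, totalDeriv_apply, mongeField, map_sub, map_smul, smul_eq_mul]
  have key' : ∀ lam : (Fin n → ℝ) → Fin n → ℝ, jetCoord (r.val + 1) j (mongeField p lam i q) =
      jetCoord (r.val + 1) j (evolField p lam q) -
        lam (q 0) i * jetCoord (r.val + 1) j (totalField n p q) := by
    intro lam
    simp only [← jetCoordCLM_apply, mongeField, map_sub, map_smul, smul_eq_mul]
  have hflux := fderiv_flux_evolField_comm (p := p) hU hlam hmu hhyp hcomm j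
  have hsum := hcomm.sum_eq hhyp hq i (fun k => jetCoord 1 k q)
  rw [fderiv_mongeField_apply hU hmu i hq, fderiv_mongeField_apply hU hlam i hq, key, key,
    key', key']
  simp only [mongeField_apply_zero]
  rw [hsum]
  by_cases hr : r.val < p
  · have h1 := fderiv_timeDeriv_evolField_of_lt (p := p) hU hlam hmu j (Or.inr hr) hq
    have h2 := fderiv_timeDeriv_evolField_of_lt (p := p) hU hmu hlam j (Or.inr hr) hq
    have h3 := iterate_totalDeriv_congr hU hflux r.val hq
    simp only at h1 h2
    rw [jetCoord_evolField (by omega), jetCoord_evolField (by omega), h1, h2, h3]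
    ring
  · obtain rfl : j = i := hrj.resolve_left hr
    have hrp : r.val = p := by omega
    rw [hrp, jetCoord_of_lt (by omega), jetCoord_of_lt (by omega), jetCoord_of_lt (by omega),
      jetCoord_of_lt (by omega)]
    -- In the row `r = p`, `j = i`, the truncation errors -μ^i D_x^{p+1}(λ^i u^i_x) and the
    -- transport terms -λ^i D_x^{p+1}(μ^i u^i_x) trade places when λ and μ are exchanged, so the two
    -- sides agree.
    by_cases hp : 1 ≤ p
    · rw [fderiv_timeDeriv_evolField_self hU hlam hmu j hp hq,
        fderiv_timeDeriv_evolField_self hU hmu hlam j hp hq,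
        iterate_totalDeriv_congr hU hflux p hq]
      ring
    · obtain rfl : p = 0 := by omega
      have h1 := fderiv_timeDeriv_evolField_of_lt hU hlam hmu j (Or.inl rfl) hq
      have h2 := fderiv_timeDeriv_evolField_of_lt hU hmu hlam j (Or.inl rfl) hq
      have h3 : totalField n 0 q = 0 := by
        ext r k
        rw [totalField_apply, jetCoord_of_lt (by omega)]
        rfl
      simp only at h1 h2
      rw [h1, h2, iterate_totalDeriv_congr hU hflux 0 hq, timeDeriv_succ, timeDeriv_succ,
        totalDeriv_apply, totalDeriv_apply, h3]
      simp

/-- The brackets of `∂ / ∂u^k_p`, `k ≠ i`, with `∂_t - lam^i ∂_x` and with `∂_τ - mu^i ∂_x` are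
proportional, up to `∂ / ∂u^j_p`, `j ≠ i`. -/
theorem fderiv_mongeField_jetVec (hU : IsOpen U) (hlam : ContDiffOn ℝ ∞ lam U)
    (hmu : ContDiffOn ℝ ∞ mu U) (hhyp : StrictlyHyperbolicOn lam U)
    (hcomm : SolvesCommutingSystemOn lam mu U) {i k : Fin n} (hik : i ≠ k) {q : JetFiber n p}
    (hq : q ∈ fiberOver p U) (r : Fin (p + 1)) (j : Fin n) (hrj : r.val < p ∨ j = i) :
    (lam (q 0) k - lam (q 0) i) * fderiv ℝ (mongeField p mu i) q (jetVec p p k) r j =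
      (mu (q 0) k - mu (q 0) i) * fderiv ℝ (mongeField p lam i) q (jetVec p p k) r j := by
  have hcross := hcomm.cross_mul hhyp hq i k
  rw [fderiv_mongeField_apply hU hmu i hq, fderiv_mongeField_apply hU hlam i hq,
    sum_partialDeriv_mul_jetVec, sum_partialDeriv_mul_jetVec]
  by_cases hr : r.val < p
  · rw [if_neg (by omega), if_neg (by omega), jetCoord_jetVec (by omega)]
    -- Below order `p` only the row `p - 1` is nonzero, with entry λ^k - λ^i (respectively μ^k -
    -- μ^i) at `j = k`.
    by_cases hr' : r.val + 1 = p
    · have h1 := fderiv_timeDeriv_jetVec_succ (p := p) hU hlam (s := r.val) (by omega) j k hq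
      have h2 := fderiv_timeDeriv_jetVec_succ (p := p) hU hmu (s := r.val) (by omega) j k hq
      rw [hr'] at h1 h2
      rw [h1, h2]
      by_cases hjk : j = k
      · simp only [hjk, hr', if_true, and_self]
        ring
      · simp [hjk]
    · rw [fderiv_timeDeriv_jetVec_eq_zero hU hlam (by omega) j k hq,
        fderiv_timeDeriv_jetVec_eq_zero hU hmu (by omega) j k hq, if_neg (by tauto)]
      ring
  · obtain rfl : j = i := hrj.resolve_left hr
    have hrp : r.val = p := by omega
    rw [hrp, jetCoord_of_lt (by omega), jetCoord_of_lt (by omega),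
      fderiv_timeDeriv_jetVec_self hU hlam le_rfl hik hq,
      fderiv_timeDeriv_jetVec_self hU hmu le_rfl hik hq]
    linear_combination jetCoord 1 j q * hcross

end CommutingFlow

/-! ### Riemann invariants under the commuting flow. -/

section RiemannInvariants

variable {n p : ℕ} {U : Set (Fin n → ℝ)} {lam mu : (Fin n → ℝ) → Fin n → ℝ} {i : Fin n}

/-- The field `s ∂_t - lam^i ∂_x` along the `i`-th Monge distribution; it lies in the distribution
if `s = 1`. -/
noncomputable def charField (p : ℕ) (s : ℝ) (lam : (Fin n → ℝ) → Fin n → ℝ) (i : Fin n)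
    (z : JetSpace n p) : JetSpace n p :=
  (-lam (z.2.2 0) i, s, mongeField p lam i z.2.2)

theorem charField_one_mem (z : JetSpace n p) : charField p 1 lam i z ∈ mongeDistribution lam i z :=
  ⟨by simp [charField], fun r j _ => by simp [charField, mongeField_apply]⟩

theorem mem_mongeDistribution_of_vertical {z : JetSpace n p} {w : JetFiber n p}
    (hw : ∀ (r : Fin (p + 1)) (j : Fin n), r.val < p ∨ j = i → w r j = 0) :
    ((0, 0, w) : JetSpace n p) ∈ mongeDistribution lam i z :=
  ⟨by simp, fun r j h => by simp [hw r j h]⟩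

theorem jetVec_mem_mongeDistribution {k : Fin n} (hk : k ≠ i) (z : JetSpace n p) :
    ((0, 0, jetVec p p k) : JetSpace n p) ∈ mongeDistribution lam i z :=
  mem_mongeDistribution_of_vertical fun r j h => by
    rw [jetVec, if_neg]
    rintro ⟨h1, h2⟩
    rcases h with h | h
    · omega
    · exact hk (h2.symm.trans h)

/-- The equations leave free only the `t`-component and the components u^k_p with k ≠ i, so T and
the fields ∂/∂u^k_p span the distribution and first integrals need testing only on them. -/
theorem apply_eq_zero_of_mem_mongeDistribution (A : JetSpace n p →L[ℝ] ℝ) {z : JetSpace n p}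
    (h1 : A (charField p 1 lam i z) = 0) (h2 : ∀ k, k ≠ i → A (0, 0, jetVec p p k) = 0)
    {v : JetSpace n p} (hv : v ∈ mongeDistribution lam i z) : A v = 0 := by
  obtain ⟨hv1, hv2⟩ := hv
  have hdec : v = v.2.1 • charField p 1 lam i z +
      ∑ k, (if k = i then 0 else
        (v.2.2 (Fin.last p) k - v.2.1 * mongeField p lam i z.2.2 (Fin.last p) k)) •
          ((0, 0, jetVec p p k) : JetSpace n p) := by
    refine Prod.ext ?_ (Prod.ext ?_ ?_)
    · simp only [charField, Prod.fst_add, Prod.smul_fst, Prod.fst_sum, smul_eq_mul, mul_zero,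
        Finset.sum_const_zero, add_zero]
      linear_combination hv1
    · simp only [charField, Prod.snd_add, Prod.fst_add, Prod.smul_snd, Prod.smul_fst,
        Prod.snd_sum, Prod.fst_sum, smul_eq_mul, mul_zero, Finset.sum_const_zero, add_zero,
        mul_one]
    · ext r j
      simp only [charField, Prod.snd_add, Prod.smul_snd, Prod.snd_sum, Pi.add_apply,
        Pi.smul_apply, Finset.sum_apply, smul_eq_mul]
      by_cases hrj : r.val < p ∨ j = i
      · have hz : ∀ k, (if k = i then 0 else (v.2.2 (Fin.last p) k -
            v.2.1 * mongeField p lam i z.2.2 (Fin.last p) k)) * jetVec p p k r j = 0 := by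
          intro k
          by_cases hk : k = i
          · simp [hk]
          · rcases hrj with h | h
            · simp [jetVec, h.ne]
            · simp [jetVec, h, Ne.symm hk]
        rw [Finset.sum_eq_zero fun k _ => hz k, hv2 r j hrj, mongeField_apply]
        ring
      · have hr : r = Fin.last p := by
          ext
          simp only [Fin.val_last]
          omega
        have hj : j ≠ i := fun h => hrj (Or.inr h)
        rw [Finset.sum_eq_single j]
        · rw [if_neg hj, hr]
          simp [jetVec]
        · intro k _ hk
          simp [jetVec, Ne.symm hk]
        · simp
  rw [hdec, map_add, map_smul, h1, map_sum, Finset.sum_eq_zero]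
  · simp
  · intro k _
    by_cases hk : k = i
    · simp [hk]
    · rw [map_smul, h2 k hk, smul_zero]

theorem contDiffOn_charField (hU : IsOpen U) (hlam : ContDiffOn ℝ ∞ lam U) (s : ℝ) (i : Fin n) :
    ContDiffOn ℝ ∞ (charField p s lam i) (jetsOver p U) := by
  have h : ContDiffOn ℝ ∞ (fun z : JetSpace n p => z.2.2) (jetsOver p U) :=
    (contDiff_snd.comp contDiff_snd).contDiffOn
  exact (((contDiffOn_speed hlam i).comp h (fun _ hz => hz)).neg).prodMk
    (contDiffOn_const.prodMk ((contDiffOn_mongeField hU hlam i).comp h (fun _ hz => hz)))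

theorem fderiv_charField (hU : IsOpen U) (hlam : ContDiffOn ℝ ∞ lam U) (s : ℝ) (i : Fin n)
    {z : JetSpace n p} (hz : z ∈ jetsOver p U) (v : JetSpace n p) :
    fderiv ℝ (charField p s lam i) z v =
      (-∑ k, partialDeriv lam i k (z.2.2 0) * v.2.2 0 k, 0,
        fderiv ℝ (mongeField p lam i) z.2.2 v.2.2) := by
  have hq : z.2.2 ∈ fiberOver p U := hz
  have h0 : HasFDerivAt (fun z : JetSpace n p => z.2.2)
      (.snd ℝ ℝ (JetFiber n p) ∘L .snd ℝ ℝ (ℝ × JetFiber n p)) z :=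
    (ContinuousLinearMap.snd ℝ ℝ (JetFiber n p) ∘L .snd ℝ ℝ (ℝ × JetFiber n p)).hasFDerivAt
  have h1 := HasFDerivAt.comp z (hasFDerivAt_speed hU hlam i hq).differentiableAt.hasFDerivAt h0
  have h2 := HasFDerivAt.comp z (differentiableAt_mongeField hU hlam i hq).hasFDerivAt h0
  have h3 : HasFDerivAt (charField p s lam i) _ z :=
    h1.neg.prodMk ((hasFDerivAt_const s z).prodMk h2)
  rw [h3.fderiv, ← fderiv_speed hU hlam i hq]
  rfl

/-- The Riemann invariants of a system are preserved by the commuting flow. -/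
theorem IsRiemannInvariantOn.lieDeriv (hU : IsOpen U) (hlam : ContDiffOn ℝ ∞ lam U)
    (hmu : ContDiffOn ℝ ∞ mu U) (hhyp : StrictlyHyperbolicOn lam U)
    (hcomm : SolvesCommutingSystemOn lam mu U) {V : Set (JetSpace n p)} (hV : IsOpen V)
    (hVU : V ⊆ jetsOver p U) {F : JetSpace n p → ℝ} (hF : IsRiemannInvariantOn lam i V F) :
    IsRiemannInvariantOn lam i V (fun z => fderiv ℝ F z (charField p 0 mu i z)) := by
  obtain ⟨hFs, hF0⟩ := hF
  have hS := (contDiffOn_charField (p := p) hU hmu 0 i).mono hVU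
  have hT := (contDiffOn_charField (p := p) hU hlam 1 i).mono hVU
  have hzero : ∀ {X : JetSpace n p → JetSpace n p},
      (∀ z ∈ V, X z ∈ mongeDistribution lam i z) → ∀ z ∈ V,
      fderiv ℝ (fun y => fderiv ℝ F y (X y)) z = 0 := by
    intro X hX z hz
    have : (fun y => fderiv ℝ F y (X y)) =ᶠ[𝓝 z] fun _ => (0 : ℝ) := by
      filter_upwards [hV.mem_nhds hz] with y hy using hF0 y hy _ (hX y hy)
    rw [this.fderiv_eq, fderiv_const_apply]
  refine ⟨contDiffOn_fderiv_apply hV hFs hS, fun z hz v hv => ?_⟩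
  have hq : z.2.2 ∈ fiberOver p U := hVU hz
  refine apply_eq_zero_of_mem_mongeDistribution _ ?_ (fun k hk => ?_) hv
  · have h := fderiv_commutator hV hFs hT hS hz
    rw [h, hzero (fun z _ => charField_one_mem z) z hz, zero_apply, zero_add]
    refine hF0 z hz _ ?_
    rw [fderiv_charField hU hmu 0 i (hVU hz), fderiv_charField hU hlam 1 i (hVU hz)]
    have hsum := hcomm.sum_eq hhyp hq i (fun k => jetCoord 1 k z.2.2)
    have hd : ((-∑ k, partialDeriv mu i k (z.2.2 0) * (charField p 1 lam i z).2.2 0 k, 0,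
        fderiv ℝ (mongeField p mu i) z.2.2 (charField p 1 lam i z).2.2) : JetSpace n p) -
        (-∑ k, partialDeriv lam i k (z.2.2 0) * (charField p 0 mu i z).2.2 0 k, 0,
          fderiv ℝ (mongeField p lam i) z.2.2 (charField p 0 mu i z).2.2) =
        (0, 0, fderiv ℝ (mongeField p mu i) z.2.2 (mongeField p lam i z.2.2) -
          fderiv ℝ (mongeField p lam i) z.2.2 (mongeField p mu i z.2.2)) := by
      refine Prod.ext ?_ (Prod.ext ?_ rfl)
      · simp only [charField, mongeField_apply_zero, Prod.fst_sub]
        linear_combination -hsum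
      · simp
    rw [hd]
    refine mem_mongeDistribution_of_vertical fun r j hrj => ?_
    rw [Pi.sub_apply, Pi.sub_apply,
      fderiv_mongeField_comm hU hlam hmu hhyp hcomm i hq r j hrj, sub_self]
  · set e : JetSpace n p := (0, 0, jetVec p p k) with he
    have hce : ContDiffOn ℝ ∞ (fun _ : JetSpace n p => e) V := contDiffOn_const
    have hmem : ∀ z ∈ V, e ∈ mongeDistribution lam i z := fun z _ =>
      jetVec_mem_mongeDistribution hk z
    have h1 := fderiv_commutator hV hFs hce hS hz
    have h2 := fderiv_commutator hV hFs hce hT hz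
    rw [hzero (fun z _ => charField_one_mem z) z hz] at h2
    rw [hzero hmem z hz, fderiv_const_apply] at h1 h2
    simp only [zero_apply, zero_add, sub_zero] at h1 h2
    rw [h1]
    -- By `h2`, F is killed by [∂/∂u^k_p, T], being killed by both fields. Proportionality of the
    -- brackets modulo the distribution transfers this to [∂/∂u^k_p, S] after division by λ^k - λ^i,
    -- the place where distinct speeds are essential.
    have hne : lam (z.2.2 0) k - lam (z.2.2 0) i ≠ 0 := sub_ne_zero.2 (hhyp _ hq k i hk)
    have hcross := hcomm.cross_mul hhyp hq i k
    have hX : ((lam (z.2.2 0) k - lam (z.2.2 0) i) • fderiv ℝ (charField p 0 mu i) z e -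
        (mu (z.2.2 0) k - mu (z.2.2 0) i) • fderiv ℝ (charField p 1 lam i) z e) ∈
        mongeDistribution lam i z := by
      rw [fderiv_charField hU hmu 0 i (hVU hz), fderiv_charField hU hlam 1 i (hVU hz)]
      have hd : ((lam (z.2.2 0) k - lam (z.2.2 0) i) •
          ((-∑ l, partialDeriv mu i l (z.2.2 0) * e.2.2 0 l, 0,
            fderiv ℝ (mongeField p mu i) z.2.2 e.2.2) : JetSpace n p) -
          (mu (z.2.2 0) k - mu (z.2.2 0) i) •
          ((-∑ l, partialDeriv lam i l (z.2.2 0) * e.2.2 0 l, 0,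
            fderiv ℝ (mongeField p lam i) z.2.2 e.2.2) : JetSpace n p)) =
          (0, 0, (lam (z.2.2 0) k - lam (z.2.2 0) i) •
            fderiv ℝ (mongeField p mu i) z.2.2 (jetVec p p k) -
          (mu (z.2.2 0) k - mu (z.2.2 0) i) •
            fderiv ℝ (mongeField p lam i) z.2.2 (jetVec p p k)) := by
        refine Prod.ext ?_ (Prod.ext ?_ rfl)
        · simp only [he, sum_partialDeriv_mul_jetVec, Prod.fst_sub, Prod.smul_fst, smul_eq_mul]
          by_cases hp : p = 0
          · rw [if_pos hp, if_pos hp]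
            linear_combination -hcross
          · rw [if_neg hp, if_neg hp]
            simp
        · simp
      rw [hd]
      refine mem_mongeDistribution_of_vertical fun r j hrj => ?_
      simp only [Pi.sub_apply, Pi.smul_apply, smul_eq_mul]
      rw [fderiv_mongeField_jetVec hU hlam hmu hhyp hcomm (Ne.symm hk) hq r j hrj, sub_self]
    have h3 := hF0 z hz _ hX
    rw [map_sub, map_smul, map_smul, ← h2, smul_zero, sub_zero, smul_eq_mul] at h3
    exact (mul_eq_zero.1 h3).resolve_left hne

end RiemannInvariants

/-! ### Extra invariants of the commuting flow. -/

section DarbouxIntegrability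

variable {n p : ℕ} {U : Set (Fin n → ℝ)} {lam mu : (Fin n → ℝ) → Fin n → ℝ} {i : Fin n}

theorem hasFDerivAt_coord (i : Fin n) (z : JetSpace n p) :
    HasFDerivAt (fun w : JetSpace n p => w.2.2 0 i)
      (ContinuousLinearMap.proj i ∘L ContinuousLinearMap.proj 0 ∘L
        .snd ℝ ℝ (JetFiber n p) ∘L .snd ℝ ℝ (ℝ × JetFiber n p)) z :=
  (ContinuousLinearMap.proj (R := ℝ) (φ := fun _ : Fin n => ℝ) i ∘L
    ContinuousLinearMap.proj (R := ℝ) (φ := fun _ : Fin (p + 1) => Fin n → ℝ) 0 ∘L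
      .snd ℝ ℝ (JetFiber n p) ∘L .snd ℝ ℝ (ℝ × JetFiber n p)).hasFDerivAt

theorem fderiv_coord (i : Fin n) (z v : JetSpace n p) :
    fderiv ℝ (fun w : JetSpace n p => w.2.2 0 i) z v = v.2.2 0 i := by
  rw [(hasFDerivAt_coord i z).fderiv]
  rfl

theorem charField_coord (s : ℝ) (z : JetSpace n p) : (charField p s lam i z).2.2 0 i = 0 := by
  simp [charField, mongeField_apply_zero]

/-- If the `i`-th Monge distribution of a system has an extra Riemann invariant on a nonempty open
set, then that of a commuting flow has one on a nonempty open subset. -/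
theorem IsExtraRiemannInvariantOn.exists_commuting (hU : IsOpen U) (hlam : ContDiffOn ℝ ∞ lam U)
    (hmu : ContDiffOn ℝ ∞ mu U) (hhyp : StrictlyHyperbolicOn lam U)
    (hcomm : SolvesCommutingSystemOn lam mu U) {V : Set (JetSpace n p)} (hV : IsOpen V)
    (hVU : V ⊆ jetsOver p U) (hne : V.Nonempty) {F : JetSpace n p → ℝ}
    (hF : IsExtraRiemannInvariantOn lam i V F) :
    ∃ V' ⊆ V, IsOpen V' ∧ V'.Nonempty ∧
      ∃ G : JetSpace n p → ℝ, IsExtraRiemannInvariantOn mu i V' G := by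
  obtain ⟨⟨x₁, t₀, q₁⟩, hz₁⟩ := hne
  let Fs : ℕ → JetSpace n p → ℝ := fun k =>
    Nat.rec F (fun _ H z => fderiv ℝ H z (charField p 0 mu i z)) k
  have hFs : ∀ k, IsRiemannInvariantOn lam i V (Fs k) := by
    intro k
    induction k with
    | zero => exact hF.1
    | succ k ih => exact ih.lieDeriv hU hlam hmu hhyp hcomm hV hVU
  let slice : ℝ × JetFiber n p → JetSpace n p := fun y => (y.1, t₀, y.2)
  have hslice : ContDiff ℝ ∞ slice := contDiff_fst.prodMk (contDiff_const.prodMk contDiff_snd)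
  have hsliced : ∀ y, HasFDerivAt slice
      ((ContinuousLinearMap.fst ℝ ℝ (JetFiber n p)).prod
        ((0 : ℝ × JetFiber n p →L[ℝ] ℝ).prod (.snd ℝ ℝ (JetFiber n p)))) y := fun y =>
    hasFDerivAt_fst.prodMk ((hasFDerivAt_const t₀ y).prodMk hasFDerivAt_snd)
  set N : Set (ℝ × JetFiber n p) := slice ⁻¹' V with hN
  have hNo : IsOpen N := hV.preimage hslice.continuous
  let S : ℝ × JetFiber n p → ℝ × JetFiber n p := fun y =>
    (-mu (y.2 0) i, mongeField p mu i y.2)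
  -- The sequence u^i, F, SF, S²F, … on the slice `t = t₀`. The index is shifted by one because S
  -- kills u^i, so F cannot be reached from it.
  let Φ : ℕ → ℝ × JetFiber n p → ℝ := fun k =>
    Nat.casesOn k (fun y => y.2 0 i) (fun k y => Fs k (slice y))
  have hΦ0 : ∀ y v, fderiv ℝ (Φ 0) y v = v.2 0 i := by
    intro y v
    have h : HasFDerivAt (Φ 0) _ y := (hasFDerivAt_coord i (slice y)).comp y (hsliced y)
    rw [h.fderiv]
    rfl
  have hΦs : ∀ k, ∀ y ∈ N, ∀ v, fderiv ℝ (Φ (k + 1)) y v =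
      fderiv ℝ (Fs k) (slice y) (v.1, 0, v.2) := by
    intro k y hy v
    have h : HasFDerivAt (Φ (k + 1)) _ y := HasFDerivAt.comp y
      ((((hFs k).1.contDiffAt (hV.mem_nhds hy)).differentiableAt (by simp)).hasFDerivAt) (hsliced y)
    rw [h.fderiv]
    rfl
  obtain ⟨y₀, hy₀, G, hG⟩ := exists_timeDependent_firstIntegral hNo ⟨(x₁, q₁), hz₁⟩ S Φ
    (fun k => by
      cases k with
      | zero => exact (((contDiff_apply ℝ ℝ i).comp (contDiff_apply ℝ (Fin n → ℝ)
          (0 : Fin (p + 1)))).comp contDiff_snd).contDiffOn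
      | succ k => exact (hFs k).1.comp hslice.contDiffOn (fun _ h => h))
    (fun y _ => by
      rw [hΦ0]
      exact charField_coord 0 (slice y))
    (fun k y hy => hΦs k y hy _)
    (fun y hy => by
      have h := hF.2 _ hy
      rw [LinearIndependent.pair_iff] at h ⊢
      intro a b hab
      refine h a b ?_
      refine ContinuousLinearMap.ext fun v => ?_
      -- T is transversal to the slice and is killed by both du^i and dF, so a linear relation
      -- between their restrictions to the slice is a relation on the whole space.
      have hT1 : fderiv ℝ F (slice y) (charField p 1 lam i (slice y)) = 0 :=
        hF.1.2 _ hy _ (charField_one_mem _)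
      have hdec : v = v.2.1 • charField p 1 lam i (slice y) +
          ((v - v.2.1 • charField p 1 lam i (slice y)).1, 0,
            (v - v.2.1 • charField p 1 lam i (slice y)).2.2) := by
        refine Prod.ext ?_ (Prod.ext ?_ ?_)
        · simp
        · simp [charField]
        · simp
      set w := v - v.2.1 • charField p 1 lam i (slice y) with hw
      have h1 := congrArg (fun L => L (w.1, w.2.2)) hab
      simp only [add_apply, smul_apply, smul_eq_mul, zero_apply, hΦ0, hΦs 0 y hy] at h1
      change a * w.2.2 0 i + b * fderiv ℝ F (slice y) (w.1, 0, w.2.2) = 0 at h1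
      have h2 : v.2.2 0 i = w.2.2 0 i := by
        change _ = v.2.2 0 i - v.2.1 * (charField p 1 lam i (slice y)).2.2 0 i
        rw [charField_coord]
        ring
      simp only [add_apply, smul_apply, smul_eq_mul, zero_apply, fderiv_coord]
      rw [h2]
      conv_lhs => rw [hdec]
      rw [map_add, map_smul, hT1, smul_zero, zero_add]
      exact h1) t₀
  -- Moves the time coordinate to the front; that coordinate now plays the role of τ.
  let κ : JetSpace n p →L[ℝ] ℝ × ℝ × JetFiber n p :=
    (ContinuousLinearMap.fst ℝ ℝ (JetFiber n p) ∘L .snd ℝ ℝ (ℝ × JetFiber n p)).prod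
      ((ContinuousLinearMap.fst ℝ ℝ (ℝ × JetFiber n p)).prod
        (.snd ℝ ℝ (JetFiber n p) ∘L .snd ℝ ℝ (ℝ × JetFiber n p)))
  have hκ : Filter.Tendsto κ (𝓝 (slice y₀)) (𝓝 (t₀, y₀)) := κ.continuous.tendsto (slice y₀)
  have hN' : ∀ᶠ w : ℝ × ℝ × JetFiber n p in 𝓝 (t₀, y₀), w.2 ∈ N :=
    (continuous_snd.tendsto (t₀, y₀)).eventually (hNo.mem_nhds hy₀)
  obtain ⟨V', hV', hV'o, hmem⟩ := eventually_nhds_iff.1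
    ((hκ.eventually (hG.and hN')).and (hV.mem_nhds hy₀))
  have hGκ : ∀ z ∈ V', HasFDerivAt (G ∘ κ) (fderiv ℝ G (κ z) ∘L κ) z := fun z hz =>
    HasFDerivAt.comp z ((hV' z hz).1.1.1.differentiableAt (by simp)).hasFDerivAt κ.hasFDerivAt
  refine ⟨V', fun z hz => (hV' z hz).2, hV'o, ⟨_, hmem⟩, G ∘ κ, ⟨?_, ?_⟩, ?_⟩
  · intro z hz
    exact ((hV' z hz).1.1.1.comp z κ.contDiff.contDiffAt).contDiffWithinAt
  · intro z hz v hv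
    obtain ⟨⟨⟨-, hGT, hGV, -⟩, hyN⟩, -⟩ := hV' z hz
    rw [(hGκ z hz).fderiv]
    refine apply_eq_zero_of_mem_mongeDistribution _ hGT (fun k hk => ?_) hv
    -- The vertical fields are common to both distributions and kill u^i and all the S^l F, hence G.
    refine hGV (0, jetVec p p k) fun l => ?_
    cases l with
    | zero =>
      rw [hΦ0]
      simp [jetVec, Ne.symm hk]
    | succ l =>
      rw [hΦs l _ hyN]
      exact (hFs l).2 _ hyN _ (jetVec_mem_mongeDistribution hk _)
  · intro z hz
    have h := (hV' z hz).1.1.2.2.2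
    have hyN := (hV' z hz).1.2
    have h0 : HasFDerivAt (fun w : JetSpace n p => w.2.2 0 i)
        (fderiv ℝ (fun w : ℝ × ℝ × JetFiber n p => Φ 0 w.2) (κ z) ∘L κ) z := by
      have hd : DifferentiableAt ℝ (fun w : ℝ × ℝ × JetFiber n p => Φ 0 w.2) (κ z) := by
        change DifferentiableAt ℝ (fun w : ℝ × ℝ × JetFiber n p => w.2.2 0 i) (κ z)
        fun_prop
      exact HasFDerivAt.comp z hd.hasFDerivAt κ.hasFDerivAt
    rw [(hGκ z hz).fderiv, h0.fderiv]
    rw [LinearIndependent.pair_iff] at h ⊢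
    intro a b hab
    refine h a b ?_
    refine ContinuousLinearMap.ext fun v => ?_
    exact congrArg (fun L => L ((v.2.1, v.1, v.2.2) : JetSpace n p)) hab

/-- The invariant of μ appears only on some open subset of a given neighbourhood, not near a
prescribed point. Shrinking the neighbourhood first into an arbitrary open set `O` shows that the
set of all points with a local extra invariant is dense. -/
theorem AdmitsExtraRiemannInvariant.commuting (hU : IsOpen U) (hlam : ContDiffOn ℝ ∞ lam U)
    (hmu : ContDiffOn ℝ ∞ mu U) (hhyp : StrictlyHyperbolicOn lam U)
    (hcomm : SolvesCommutingSystemOn lam mu U) (h : AdmitsExtraRiemannInvariant lam U p i) :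
    AdmitsExtraRiemannInvariant mu U p i := by
  obtain ⟨W, hWo, hWU, hWd, hW⟩ := h
  refine ⟨{z | ∃ V : Set (JetSpace n p), IsOpen V ∧ z ∈ V ∧ V ⊆ jetsOver p U ∧
    ∃ F : JetSpace n p → ℝ, IsExtraRiemannInvariantOn mu i V F}, ?_, ?_, ?_, ?_⟩
  · rw [isOpen_iff_mem_nhds]
    rintro z ⟨V, hV, hz, hVU, hF⟩
    filter_upwards [hV.mem_nhds hz] with y hy using ⟨V, hV, hy, hVU, hF⟩
  · rintro z ⟨V, -, hz, hVU, -⟩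
    exact hVU hz
  · intro z hz
    rw [mem_closure_iff]
    intro O hO hzO
    obtain ⟨y, hyO, hyW⟩ := mem_closure_iff.1 (hWd hz) O hO hzO
    obtain ⟨V, hV, hyV, hVW, F, ⟨hFs, hF0⟩, hFi⟩ := hW y hyW
    have hsub : O ∩ V ⊆ V := Set.inter_subset_right
    obtain ⟨V', hV'V, hV', ⟨y', hy'⟩, G, hG⟩ :=
      IsExtraRiemannInvariantOn.exists_commuting (F := F) hU hlam hmu hhyp hcomm (hO.inter hV)
        (hsub.trans (hVW.trans hWU)) ⟨y, hyO, hyV⟩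
        ⟨⟨hFs.mono hsub, fun z hz => hF0 z (hsub hz)⟩, fun z hz => hFi z (hsub hz)⟩
    exact ⟨y', (hV'V hy').1, V', hV', hy', (hV'V.trans hsub).trans (hVW.trans hWU), G, hG⟩
  · rintro z ⟨V, hV, hz, hVU, hF⟩
    exact ⟨V, hV, hz, fun y hy => ⟨V, hV, hy, hVU, hF⟩, hF⟩

end DarbouxIntegrability

theorem theorem2 {n : ℕ} (U : Set (Fin n → ℝ)) (hU : IsOpen U)
    (lam mu : (Fin n → ℝ) → Fin n → ℝ)
    (hlam : ContDiffOn ℝ ∞ lam U) (hmu : ContDiffOn ℝ ∞ mu U)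
    (hhyp : StrictlyHyperbolicOn lam U)
    (hcomm : SolvesCommutingSystemOn lam mu U) :
    (DarbouxIntegrable lam U → DarbouxIntegrable mu U) ∧
      ∀ p : ℕ, DarbouxIntegrableInOrder lam U p → DarbouxIntegrableInOrder mu U p := by
  refine ⟨fun h i => ?_, fun p h i => (h i).commuting hU hlam hmu hhyp hcomm⟩
  obtain ⟨p, hp⟩ := h i
  exact ⟨p, hp.commuting hU hlam hmu hhyp hcomm⟩
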